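/- Consider the randomized radio network model with collision detection ($\mathsf{CD}$). The network is a connected undirected graph $G$ with $n \ge 3$ vertices and maximum degree $\Delta$. The devices at the vertices are anonymous: all run the same algorithm, and initially a device knows only $n$, $\Delta$, its private independent fair random bits, and whether it is the source $s$; the source also holds a message $m$ (a finite bit string). Time consists of synchronous slots. In each slot each device sends a message, listens, or stays idle. A device that sends or stays idle gets no feedback. A listener hears silence if no neighbor sends, the message if exactly one neighbor sends it, and noise if at least two neighbors send. The energy of a device is the number of slots in which it sends or listens; local computation is free. An execution of $\mathsf{Broadcast}$ succeeds if at its end every device outputs $m$. Theorem. For every $k \in \mathbb{N}$ there is a constant $C > 0$, depending only on $k$, such that for every $\epsilon \in (0,1)$ and all $n \ge 3$ and $\Delta$ there is a randomized algorithm in this model with the following properties on every connected graph with $n$ vertices and maximum degree $\Delta$, for every source $s$ and every message $m$. It always runs for at most $$C \cdot \frac{n \,\log \Delta\, (\log n)^{2+\epsilon}}{\epsilon \log\log n}$$ time slots, in every execution every device spends at most $$C \cdot \frac{(\log n)^2}{\epsilon \log\log n}$$ energy, and with probability at least $1 - n^{-k}$ all devices output $m$. (Here $\log$ is the natural logarithm.)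 -/

import Mathlib

/-!  Synchronous multi-hop radio networks with collision detection, and randomized broadcast
protocols for anonymous devices. -/

namespace Radio

/-- Messages are finite bit strings. -/
abbrev Msg : Type := List Bool

/-- What a device does in a time slot. -/
inductive Act : Type where
  | send (m : Msg) : Act
  | listen : Act
  | idle : Act

/-- What a device gets from the environment in a time slot.  A device that sends or stays idle
gets `nothing`; a listener hears `silence`, `noise` or a message. -/
inductive Feedback : Type where
  | nothing : Feedback
  | silence : Feedback
  | noise : Feedback
  | message (m : Msg) : Feedback

/-- A randomized protocol, to be run by every device of an anonymous network.

A device knows its input (`some m` for the source holding `m`, and `none` for all the other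
devices), its private random bits, and the feedback of all earlier slots, in order.  The number of
the current slot is the length of that list, and the device's own earlier actions are determined by
these data.  Local computation is free and unrestricted.  After `slots` slots the device outputs
a message. -/
structure Protocol : Type where
  /-- number of private random bits of each device -/
  bits : ℕ
  /-- running time: the number of time slots -/
  slots : ℕ
  /-- the action in the slot that follows the given history -/
  act : Option Msg → (Fin bits → Bool) → List Feedback → Act
  /-- the message output at the end -/
  output : Option Msg → (Fin bits → Bool) → List Feedback → Msg

variable {V : Type*} [Fintype V]

open Classical in
/-- The neighbors of `v` that send when the devices act according to `a`. -/
noncomputable def senders (G : SimpleGraph V) (a : V → Act) (v : V) : Finset V :=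
  Finset.univ.filter fun u => G.Adj v u ∧ ∃ m, a u = Act.send m

open Classical in
/-- What a listener `v` hears in the collision detection model: silence if no neighbor sends, the
message if exactly one neighbor sends, and noise if at least two neighbors send. -/
noncomputable def hearCD (G : SimpleGraph V) (a : V → Act) (v : V) : Feedback :=
  if senders G a v = ∅ then Feedback.silence
  else if h : ∃ m u, senders G a v = {u} ∧ a u = Act.send m then Feedback.message h.choose
  else Feedback.noise

/-- The feedback given to `v` in a slot. -/
noncomputable def feedbackCD (G : SimpleGraph V) (a : V → Act) (v : V) : Feedback :=
  match a v with
  | Act.listen => hearCD G a v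
  | Act.send _ => Feedback.nothing
  | Act.idle => Feedback.nothing

open Classical in
/-- The input of device `v` when the source `s` holds the message `m`. -/
noncomputable def input (s : V) (m : Msg) (v : V) : Option Msg :=
  if v = s then some m else none

namespace Protocol

variable (P : Protocol)

/-- The feedback that `v` got in the first `t` slots, if the source `s` holds `m` and the private
random bits of the devices are `r`. -/
noncomputable def history (G : SimpleGraph V) (s : V) (m : Msg) (r : V → Fin P.bits → Bool) :
    ℕ → V → List Feedback
  | 0 => fun _ => []
  | t + 1 => fun v =>
      history G s m r t v ++
        [feedbackCD G (fun u => P.act (input s m u) (r u) (history G s m r t u)) v]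

/-- The action of `v` in slot `t` (slots are numbered from `0`). -/
noncomputable def action (G : SimpleGraph V) (s : V) (m : Msg) (r : V → Fin P.bits → Bool)
    (t : ℕ) (v : V) : Act :=
  P.act (input s m v) (r v) (P.history G s m r t v)

open Classical in
/-- The energy spent by `v`: the number of slots in which it sends or listens. -/
noncomputable def energy (G : SimpleGraph V) (s : V) (m : Msg) (r : V → Fin P.bits → Bool)
    (v : V) : ℕ :=
  ((Finset.range P.slots).filter fun t => P.action G s m r t v ≠ Act.idle).card

/-- Broadcast succeeds: at the end every device knows the message of the source. -/
def Succeeds (G : SimpleGraph V) (s : V) (m : Msg) (r : V → Fin P.bits → Bool) : Prop :=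
  ∀ v, P.output (input s m v) (r v) (P.history G s m r P.slots v) = m

open Classical in
/-- The probability that broadcast succeeds, where all private random bits of all devices are
independent and fair. -/
noncomputable def successProb (G : SimpleGraph V) (s : V) (m : Msg) : ℝ :=
  ((Finset.univ.filter fun r : V → Fin P.bits → Bool => P.Succeeds G s m r).card : ℝ) /
    (Fintype.card (V → Fin P.bits → Bool) : ℝ)

end Protocol

end Radio

/-! The algorithm maintains a labeling in which every positive label has a neighbor whose label is
one smaller. Such a labeling is a family of rooted clusters (roots have label 0) along which
information moves up and down with few awake slots. At the start every vertex is its own cluster;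
rounds of merging reduce the number of clusters to one, and then the message goes from the source up
to the root and down to everybody.

The primitive is an `Exchange`: some devices send, others want to receive. One detection slot tells
a receiver whether it has any sending neighbor, so a fruitless attempt costs 1. Otherwise, in each
phase of `W` slots (`W` about log Δ) a sender picks slot `j` with probability 2^-(j+1), and the
receiver listens in one slot `p` only: after silence it decreases `p`, after noise it increases `p`.
This walk drifts to the logarithm of the number of senders, where a message arrives with constant
probability. By `walk_step` a potential shrinks by the factor 0.985 per phase, so O(log n) phases
suffice with high probability (`Exchange.wp_prog_le`), at one unit of energy per phase.

In a merging round each root draws a delay below `d = q ^ 6`, of order (log n)^ε, and starts a new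
cluster at that time unless it was reached before. Reached clusters absorb adjacent clusters, and a
hop in the cluster graph takes at most two time rounds. Hence a root survives only if its delay is
less than every other delay plus twice the distance (`Wave.lt_of_start`). Then the expected excess
of the number of clusters over 1 shrinks by the factor 6/q (`avg_starters_le`), so that O(log n / (ε
log log n)) merging rounds leave a single cluster with high probability.

A merging round takes `2 * n * d` exchanges of O(log n log Δ) slots each, which gives the time
bound. A device listens in vain O(d) times, receives once and sends at most three times, which is
O(d + log n) energy; since d = O(log n), summing over the merging rounds gives the energy bound
(`pay_broadcastProg`). The energy is bounded against arbitrary feedback (`Pay`), hence in every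
execution. -/

set_option linter.unusedSectionVars false

namespace Radio

open Finset

/-! ### Uniform averages over finite types -/

/-- The average of `f` over a finite type. -/
noncomputable def avg {Ω : Type*} [Finite Ω] (f : Ω → ℝ) : ℝ :=
  letI := Fintype.ofFinite Ω
  (∑ x, f x) / Fintype.card Ω

section avg

variable {Ω Ω' : Type*} [Finite Ω] [Finite Ω']

theorem avg_eq [h : Fintype Ω] (f : Ω → ℝ) : avg f = (∑ x, f x) / Fintype.card Ω := by
  have : h = Fintype.ofFinite Ω := Subsingleton.elim _ _
  subst this
  rfl

theorem avg_mono {f g : Ω → ℝ} (h : ∀ x, f x ≤ g x) : avg f ≤ avg g := by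
  cases nonempty_fintype Ω
  rw [avg_eq, avg_eq]
  gcongr with x
  exact h x

theorem avg_const [Nonempty Ω] (a : ℝ) : avg (fun _ : Ω => a) = a := by
  cases nonempty_fintype Ω
  rw [avg_eq]
  simp

theorem avg_add (f g : Ω → ℝ) : avg (fun x => f x + g x) = avg f + avg g := by
  cases nonempty_fintype Ω
  simp only [avg_eq, sum_add_distrib, add_div]

theorem avg_const_mul (a : ℝ) (f : Ω → ℝ) : avg (fun x => a * f x) = a * avg f := by
  cases nonempty_fintype Ω
  simp only [avg_eq, ← mul_sum, mul_div_assoc]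

theorem avg_sum {ι : Type*} (s : Finset ι) (f : ι → Ω → ℝ) :
    avg (fun x => ∑ i ∈ s, f i x) = ∑ i ∈ s, avg (f i) := by
  cases nonempty_fintype Ω
  simp only [avg_eq, ← sum_div]
  rw [sum_comm]

theorem avg_le_const [Nonempty Ω] {f : Ω → ℝ} {a : ℝ} (h : ∀ x, f x ≤ a) : avg f ≤ a :=
  (avg_mono h).trans_eq (avg_const a)

theorem avg_equiv (e : Ω ≃ Ω') (f : Ω' → ℝ) : avg (fun x => f (e x)) = avg f := by
  cases nonempty_fintype Ω
  cases nonempty_fintype Ω'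
  rw [avg_eq, avg_eq, Fintype.card_congr e, Equiv.sum_comp e f]

theorem avg_prod (f : Ω × Ω' → ℝ) : avg f = avg fun x => avg fun y => f (x, y) := by
  cases nonempty_fintype Ω
  cases nonempty_fintype Ω'
  simp only [avg_eq, Fintype.sum_prod_type, Fintype.card_prod, Nat.cast_mul, ← sum_div]
  rw [div_div, mul_comm]

theorem avg_prod_fst [Nonempty Ω'] (f : Ω → ℝ) : avg (fun x : Ω × Ω' => f x.1) = avg f := by
  rw [avg_prod]
  simp only [avg_const]

theorem avg_prod_snd [Nonempty Ω] (f : Ω' → ℝ) : avg (fun x : Ω × Ω' => f x.2) = avg f := by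
  rw [avg_prod]
  simp only [avg_const]

/-- Coordinates of a uniformly random function are independent and uniform. -/
theorem avg_pi_prod {V : Type*} [Fintype V] (f : V → Ω → ℝ) :
    avg (fun x : V → Ω => ∏ v, f v (x v)) = ∏ v, avg (f v) := by
  classical
  cases nonempty_fintype Ω
  simp only [avg_eq, prod_div_distrib]
  rw [← Fintype.piFinset_univ, ← prod_univ_sum]
  simp

theorem avg_pi_prod_subset {V : Type*} [Fintype V] [Nonempty Ω] (S : Finset V) (f : V → Ω → ℝ) :
    avg (fun x : V → Ω => ∏ v ∈ S, f v (x v)) = ∏ v ∈ S, avg (f v) := by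
  classical
  have := avg_pi_prod (fun v y => if v ∈ S then f v y else 1)
  simp only [prod_ite_mem, univ_inter] at this
  rw [this, ← prod_subset (subset_univ S)]
  · exact prod_congr rfl fun v hv => by simp [hv]
  · intro v _ hv
    simp [hv, avg_const]

theorem avg_pi_eval {V : Type*} [Fintype V] [Nonempty Ω] (v : V) (f : Ω → ℝ) :
    avg (fun x : V → Ω => f (x v)) = avg f := by
  simpa using avg_pi_prod_subset {v} (fun _ => f)

end avg

/-! ### Programs made of macro-steps -/

/-- A macro-step: the device fixes its actions in a block of slots in advance, as a function of
its state and fresh random data, and updates its state after the block. -/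
structure Step (σ X : Type) : Type where
  /-- the planned actions -/
  plan : σ → X → ℕ → Act
  /-- the new state, given the feedback -/
  upd : σ → X → (ℕ → Feedback) → σ

variable {σ X : Type} {V : Type*} [Fintype V]

/-- The feedback that `v` gets in slot `j` of a macro-step of width `W`. -/
noncomputable def Step.hear (S : Step σ X) (W : ℕ) (G : SimpleGraph V) (c : V → σ) (x : V → X)
    (v : V) (j : ℕ) : Feedback :=
  if j < W then feedbackCD G (fun u => S.plan (c u) (x u) j) v else Feedback.nothing

/-- The effect of a macro-step of width `W` on the states of all devices. -/
noncomputable def Step.next (S : Step σ X) (W : ℕ) (G : SimpleGraph V) (c : V → σ) (x : V → X)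
    (v : V) : σ :=
  S.upd (c v) (x v) (S.hear W G c x v)

/-- The states after running a program. -/
noncomputable def run (W : ℕ) (G : SimpleGraph V) :
    (l : List (Step σ X)) → (V → σ) → (Fin l.length → V → X) → V → σ
  | [], c, _ => c
  | S :: l, c, z => run W G l (S.next W G c (z 0)) fun i => z i.succ

/-- The expectation of `f` after running a program. -/
noncomputable def wp [Finite X] (W : ℕ) (G : SimpleGraph V) :
    List (Step σ X) → ((V → σ) → ℝ) → (V → σ) → ℝ
  | [], f, c => f c
  | S :: l, f, c => avg fun x : V → X => wp W G l f (S.next W G c x)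

section wp

variable [Finite X] {W : ℕ} {G : SimpleGraph V}

theorem wp_append (l₁ l₂ : List (Step σ X)) (f : (V → σ) → ℝ) (c : V → σ) :
    wp W G (l₁ ++ l₂) f c = wp W G l₁ (wp W G l₂ f) c := by
  induction l₁ generalizing c with
  | nil => rfl
  | cons S l ih => simp only [List.cons_append, wp, ih]

/-- Monotonicity along an invariant of the program. -/
theorem wp_mono_of_invariant {l : List (Step σ X)} {Inv : (V → σ) → Prop}
    (hInv : ∀ S ∈ l, ∀ c x, Inv c → Inv (S.next W G c x)) {f g : (V → σ) → ℝ}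
    (hfg : ∀ c, Inv c → f c ≤ g c) {c : V → σ} (hc : Inv c) : wp W G l f c ≤ wp W G l g c := by
  induction l generalizing c with
  | nil => exact hfg c hc
  | cons S l ih =>
    exact avg_mono fun x => ih (fun S' hS' => hInv S' (List.mem_cons_of_mem _ hS'))
      (hInv S List.mem_cons_self c x hc)

theorem wp_mono {l : List (Step σ X)} {f g : (V → σ) → ℝ} (hfg : ∀ c, f c ≤ g c) (c : V → σ) :
    wp W G l f c ≤ wp W G l g c :=
  wp_mono_of_invariant (Inv := fun _ => True) (fun _ _ _ _ _ => trivial) (fun c _ => hfg c) trivial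

theorem wp_add (l : List (Step σ X)) (f g : (V → σ) → ℝ) (c : V → σ) :
    wp W G l (fun c => f c + g c) c = wp W G l f c + wp W G l g c := by
  induction l generalizing c with
  | nil => rfl
  | cons S l ih => simp only [wp, ih, avg_add]

theorem wp_const_mul (l : List (Step σ X)) (a : ℝ) (f : (V → σ) → ℝ) (c : V → σ) :
    wp W G l (fun c => a * f c) c = a * wp W G l f c := by
  induction l generalizing c with
  | nil => rfl
  | cons S l ih => simp only [wp, ih, avg_const_mul]

theorem wp_const [Nonempty X] (l : List (Step σ X)) (a : ℝ) (c : V → σ) :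
    wp W G l (fun _ => a) c = a := by
  induction l generalizing c with
  | nil => rfl
  | cons S l ih => simp only [wp, ih, avg_const]

theorem wp_sum [Nonempty X] {ι : Type*} (l : List (Step σ X)) (s : Finset ι)
    (f : ι → (V → σ) → ℝ) (c : V → σ) :
    wp W G l (fun c => ∑ i ∈ s, f i c) c = ∑ i ∈ s, wp W G l (f i) c := by
  classical
  induction s using Finset.induction_on with
  | empty => simp [wp_const]
  | insert i s hi ih => simp only [sum_insert hi, wp_add, ih]

/-- This links the recursive semantics, suited to induction over programs, with the single uniform
average over all random bits in `successProb`. -/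
theorem wp_eq_avg (l : List (Step σ X)) (f : (V → σ) → ℝ) (c : V → σ) :
    wp W G l f c = avg fun z : Fin l.length → V → X => f (run W G l c z) := by
  induction l generalizing c with
  | nil =>
    simp only [wp, run]
    exact (avg_const (Ω := Fin 0 → V → X) (f c)).symm
  | cons S l ih =>
    simp only [wp, run, ih]
    rw [← avg_prod (fun p : (V → X) × (Fin l.length → V → X) =>
      f (run W G l (S.next W G c p.1) p.2)),
      ← avg_equiv (Fin.consEquiv fun _ : Fin (l.length + 1) => V → X)]
    rfl

end wp

/-! ### Worst-case energy of programs -/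

open Classical in
/-- The energy of a macro-step. -/
noncomputable def Step.cost (S : Step σ X) (W : ℕ) (st : σ) (x : X) : ℕ :=
  ((range W).filter fun j => S.plan st x j ≠ Act.idle).card

/-- Whatever the feedback, a device that starts in state `st` with energy budget `e` stays within
its budget, and state and remaining budget satisfy `Q` at the end. -/
def Pay (W : ℕ) : List (Step σ X) → σ → ℕ → (σ → ℕ → Prop) → Prop
  | [], st, e, Q => Q st e
  | S :: l, st, e, Q => ∀ x fb, S.cost W st x ≤ e ∧ Pay W l (S.upd st x fb) (e - S.cost W st x) Q

section Pay

variable {W : ℕ}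

theorem Pay_append (l₁ l₂ : List (Step σ X)) (st : σ) (e : ℕ) (Q : σ → ℕ → Prop) :
    Pay W (l₁ ++ l₂) st e Q ↔ Pay W l₁ st e fun st' e' => Pay W l₂ st' e' Q := by
  induction l₁ generalizing st e with
  | nil => rfl
  | cons S l ih => simp only [List.cons_append, Pay, ih]

end Pay

/-! ### Programs as protocols -/

/-- The action of a device that runs a program, given its random data and the feedback so far. -/
def dev (W : ℕ) : (l : List (Step σ X)) → σ → (Fin l.length → X) → List Feedback → Act
  | [], _, _, _ => Act.idle
  | S :: l, st, y, h =>
    if h.length < W then S.plan st (y 0) h.length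
    else dev W l (S.upd st (y 0) fun j => if j < W then h.getD j Feedback.nothing else
      Feedback.nothing) (fun i => y i.succ) (h.drop W)

/-- The final state of a device that runs a program. -/
def devFinal (W : ℕ) : (l : List (Step σ X)) → σ → (Fin l.length → X) → List Feedback → σ
  | [], st, _, _ => st
  | S :: l, st, y, h =>
    devFinal W l (S.upd st (y 0) fun j => if j < W then h.getD j Feedback.nothing else
      Feedback.nothing) (fun i => y i.succ) (h.drop W)

/-- The histories when the devices choose their actions according to `A`. -/
noncomputable def hist (G : SimpleGraph V) (A : V → List Feedback → Act) : ℕ → V → List Feedback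
  | 0 => fun _ => []
  | t + 1 => fun v => hist G A t v ++ [feedbackCD G (fun u => A u (hist G A t u)) v]

theorem length_hist (G : SimpleGraph V) (A : V → List Feedback → Act) (t : ℕ) (v : V) :
    (hist G A t v).length = t := by
  induction t with
  | zero => rfl
  | succ t ih => simp [hist, ih]

/-- After `W` slots the devices behave as in a fresh run of the strategies that prepend the recorded
history; this allows peeling off one macro-step at a time. -/
theorem hist_add (G : SimpleGraph V) (A : V → List Feedback → Act) (W t : ℕ) (v : V) :
    hist G A (W + t) v = hist G A W v ++ hist G (fun u h => A u (hist G A W u ++ h)) t v := by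
  induction t generalizing v with
  | zero => simp [hist]
  | succ t ih =>
    rw [← add_assoc]
    simp only [hist, ih, List.append_assoc]

theorem hist_of_nonadaptive (G : SimpleGraph V) (A : V → List Feedback → Act) (a : V → ℕ → Act)
    (W : ℕ) (h : ∀ u h, h.length < W → A u h = a u h.length) (t : ℕ) (ht : t ≤ W) (v : V) :
    hist G A t v = (List.range t).map fun j => feedbackCD G (fun u => a u j) v := by
  induction t generalizing v with
  | zero => rfl
  | succ t ih =>
    have h1 : ∀ u, A u (hist G A t u) = a u t := fun u => by
      rw [h u _ (by rw [length_hist]; omega), length_hist]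
    simp only [hist, List.range_succ, List.map_append, ih (by omega), List.map_cons, List.map_nil]
    simp only [← ih (Nat.le_of_succ_le ht), h1]

theorem hist_block (W : ℕ) (G : SimpleGraph V) (S : Step σ X) (l : List (Step σ X)) (c : V → σ)
    (z : Fin (l.length + 1) → V → X) (v : V) (h : List Feedback) :
    let A := fun u h => dev W (S :: l) (c u) (fun i => z i u) h
    (fun j => if j < W then (hist G A W v ++ h).getD j Feedback.nothing else Feedback.nothing) =
      S.hear W G c (z 0) v := by
  intro A
  funext j
  rw [hist_of_nonadaptive G A (fun u j => S.plan (c u) (z 0 u) j) W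
    (fun u h hh => by simp [A, dev, hh]) W le_rfl, Step.hear]
  split_ifs with hj
  · rw [List.getD_append _ _ _ _ (by simpa using hj)]
    simp [hj]
  · rfl

theorem dev_append (W : ℕ) (G : SimpleGraph V) (S : Step σ X) (l : List (Step σ X)) (c : V → σ)
    (z : Fin (l.length + 1) → V → X) (v : V) (h : List Feedback) :
    let A := fun u h => dev W (S :: l) (c u) (fun i => z i u) h
    A v (hist G A W v ++ h) = dev W l (S.next W G c (z 0) v) (fun i => z i.succ v) h := by
  intro A
  have h2 := hist_block W G S l c z v h
  simp only at h2
  change dev W (S :: l) (c v) (fun i => z i v) (hist G A W v ++ h) = _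
  rw [dev, if_neg (by simp [length_hist]), h2, List.drop_append_of_le_length (by
    rw [length_hist]), List.drop_of_length_le (by rw [length_hist]), List.nil_append]
  rfl

/-- Actions within a block do not depend on feedback from that block, so the slot-by-slot execution
agrees with the block semantics `run`. -/
theorem devFinal_eq_run (W : ℕ) (G : SimpleGraph V) (l : List (Step σ X)) (c : V → σ)
    (z : Fin l.length → V → X) (v : V) :
    devFinal W l (c v) (fun i => z i v)
      (hist G (fun u h => dev W l (c u) (fun i => z i u) h) (l.length * W) v) = run W G l c z v := by
  induction l generalizing c with
  | nil => rfl
  | cons S l ih =>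
    have h0 : (S :: l).length * W = W + l.length * W := by
      rw [List.length_cons]; ring
    have h3 : (fun u h => dev W (S :: l) (c u) (fun i => z i u)
        (hist G (fun u h => dev W (S :: l) (c u) (fun i => z i u) h) W u ++ h)) =
        fun u h => dev W l (S.next W G c (z 0) u) (fun i => z i.succ u) h := by
      funext u h
      exact dev_append W G S l c z u h
    have h1 := hist_block W G S l c z v
      (hist G (fun u h => dev W l (S.next W G c (z 0) u) (fun i => z i.succ u) h) (l.length * W) v)
    simp only at h1
    rw [h0, hist_add, h3, devFinal, h1, run, ← ih (S.next W G c (z 0)) fun i => z i.succ,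
      List.drop_append_of_le_length (by rw [length_hist]),
      List.drop_of_length_le (by rw [length_hist]), List.nil_append]
    rfl

open Classical in
theorem energy_le_of_pay (W : ℕ) (G : SimpleGraph V) (l : List (Step σ X)) (c : V → σ)
    (z : Fin l.length → V → X) (v : V) (e : ℕ) {Q : σ → ℕ → Prop} (hp : Pay W l (c v) e Q) :
    ((range (l.length * W)).filter fun t =>
      (fun u h => dev W l (c u) (fun i => z i u) h) v
        (hist G (fun u h => dev W l (c u) (fun i => z i u) h) t v) ≠ Act.idle).card ≤ e := by
  induction l generalizing c e with
  | nil => simp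
  | cons S l ih =>
    have h0 : (S :: l).length * W = W + l.length * W := by
      rw [List.length_cons]; ring
    have h3 : (fun u h => dev W (S :: l) (c u) (fun i => z i u)
        (hist G (fun u h => dev W (S :: l) (c u) (fun i => z i u) h) W u ++ h)) =
        fun u h => dev W l (S.next W G c (z 0) u) (fun i => z i.succ u) h := by
      funext u h
      exact dev_append W G S l c z u h
    have hp' := hp (z 0 v) (S.hear W G c (z 0) v)
    have := ih (S.next W G c (z 0)) (fun i => z i.succ) _ hp'.2
    rw [card_filter] at this ⊢
    rw [h0, sum_range_add]
    have e1 : (∑ t ∈ range W, if (fun u h => dev W (S :: l) (c u) (fun i => z i u) h) v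
        (hist G (fun u h => dev W (S :: l) (c u) (fun i => z i u) h) t v) ≠ Act.idle
        then 1 else 0) = S.cost W (c v) (z 0 v) := by
      rw [Step.cost, card_filter]
      refine sum_congr rfl fun t ht => ?_
      have ht := mem_range.1 ht
      simp only [dev, length_hist, ht, if_true]
    have e2 : (∑ t ∈ range (l.length * W), if (fun u h => dev W (S :: l) (c u) (fun i => z i u) h) v
        (hist G (fun u h => dev W (S :: l) (c u) (fun i => z i u) h) (W + t) v) ≠ Act.idle
        then 1 else 0) ≤ e - S.cost W (c v) (z 0 v) := by
      refine le_trans (le_of_eq (sum_congr rfl fun t _ => ?_)) this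
      rw [hist_add, h3]
      have := congr_fun (congr_fun h3 v) (hist G
        (fun u h => dev W l (S.next W G c (z 0) u) (fun i => z i.succ u) h) t v)
      simp only [this]
    rw [e1]
    have := hp'.1
    omega

/-- The protocol that runs a program. -/
def toProtocol (W : ℕ) (l : List (Step σ X)) {B : ℕ} (e : (Fin B → Bool) ≃ X)
    (init : Option Msg → σ) (out : σ → Msg) : Protocol where
  bits := l.length * B
  slots := l.length * W
  act i r h := dev W l (init i) (fun j => e fun b => r (finProdFinEquiv (j, b))) h
  output i r h := out (devFinal W l (init i) (fun j => e fun b => r (finProdFinEquiv (j, b))) h)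

section toProtocol

variable (W : ℕ) (l : List (Step σ X)) {B : ℕ} (e : (Fin B → Bool) ≃ X)
  (init : Option Msg → σ) (out : σ → Msg) (G : SimpleGraph V) (s : V) (m : Msg)

/-- The random data of the steps, decoded from the random bits. -/
def decode (r : V → Fin (l.length * B) → Bool) (j : Fin l.length) (v : V) : X :=
  e fun b => r v (finProdFinEquiv (j, b))

theorem toProtocol_history (r : V → Fin (l.length * B) → Bool) (t : ℕ) (v : V) :
    (toProtocol W l e init out).history G s m r t v =
      hist G (fun u h => dev W l (init (input s m u)) (fun i => decode l e r i u) h) t v := by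
  induction t generalizing v with
  | zero => rfl
  | succ t ih =>
    simp only [Protocol.history, hist, ih]
    rfl

theorem toProtocol_energy_le (r : V → Fin (l.length * B) → Bool) (v : V) (E : ℕ)
    {Q : σ → ℕ → Prop} (hp : Pay W l (init (input s m v)) E Q) :
    (toProtocol W l e init out).energy G s m r v ≤ E := by
  classical
  have := energy_le_of_pay W G l (fun u => init (input s m u)) (decode l e r) v E hp
  refine le_trans (le_of_eq ?_) this
  unfold Protocol.energy Protocol.action
  simp only [toProtocol_history]
  congr!

theorem toProtocol_succeeds_iff (r : V → Fin (l.length * B) → Bool) :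
    (toProtocol W l e init out).Succeeds G s m r ↔
      ∀ v, out (run W G l (fun u => init (input s m u)) (decode l e r) v) = m := by
  refine forall_congr' fun v => ?_
  rw [← devFinal_eq_run, toProtocol_history]
  rfl

/-- Decoding the random bits is a bijection. -/
def decodeEquiv (V : Type*) (N : ℕ) {B : ℕ} (e : (Fin B → Bool) ≃ X) :
    (V → Fin (N * B) → Bool) ≃ (Fin N → V → X) where
  toFun r j v := e fun b => r v (finProdFinEquiv (j, b))
  invFun z v i := e.symm (z (finProdFinEquiv.symm i).1 v) (finProdFinEquiv.symm i).2
  left_inv r := by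
    funext v i
    simp only [Equiv.symm_apply_apply, Prod.mk.eta, Equiv.apply_symm_apply]
  right_inv z := by
    funext j v
    simp only [Equiv.symm_apply_apply, Equiv.apply_symm_apply]

open Classical in
theorem toProtocol_successProb [Finite X] :
    (toProtocol W l e init out).successProb G s m =
      1 - wp W G l (fun c => if ∀ v, out (c v) = m then 0 else 1) fun u => init (input s m u) := by
  have : Nonempty X := ⟨e fun _ => false⟩
  rw [wp_eq_avg, ← avg_equiv (decodeEquiv V l.length e)]
  have h1 : (toProtocol W l e init out).successProb G s m =
      avg (fun r : V → Fin (l.length * B) → Bool =>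
        if (toProtocol W l e init out).Succeeds G s m r then (1 : ℝ) else 0) := by
    rw [avg_eq, Protocol.successProb, card_filter]
    push_cast
    rfl
  rw [h1, eq_sub_iff_add_eq, ← avg_add]
  refine (congrArg avg ?_).trans (avg_const (Ω := V → Fin (l.length * B) → Bool) 1)
  funext r
  rw [toProtocol_succeeds_iff]
  change _ + (if ∀ v, out (run W G l (fun u => init (input s m u)) (decode l e r) v) = m
    then (0 : ℝ) else 1) = 1
  split_ifs <;> norm_num

end toProtocol

end Radio

namespace Radio

open Finset

/-! ### The random walk of a listener -/

/-- The potential of a walk at position `p` with target `a`. -/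
noncomputable def pot (a p : ℕ) : ℝ := (6 / 5 : ℝ) ^ ((p - a) + (a - p))

theorem one_le_pot (a p : ℕ) : 1 ≤ pot a p := one_le_pow₀ (by norm_num)

theorem pot_pos (a p : ℕ) : 0 < pot a p := zero_lt_one.trans_le (one_le_pot a p)

theorem pot_le_of_le_succ {a p q : ℕ} (h : (q - a) + (a - q) ≤ (p - a) + (a - p) + 1) :
    pot a q ≤ 6 / 5 * pot a p := by
  rw [pot, pot, ← pow_succ']
  exact pow_le_pow_right₀ (by norm_num) h

theorem pot_of_succ_eq {a p q : ℕ} (h : (q - a) + (a - q) + 1 = (p - a) + (a - p)) :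
    pot a q = 5 / 6 * pot a p := by
  rw [pot, pot, ← h, pow_succ]
  ring

theorem exp_neg_one_lt : Real.exp (-1) < 37 / 100 := by
  rw [Real.exp_neg, inv_lt_comm₀ (Real.exp_pos _) (by norm_num)]
  exact lt_trans (by norm_num) Real.exp_one_gt_d9

theorem lt_exp_neg_one : 36 / 100 < Real.exp (-1) := by
  rw [Real.exp_neg, lt_inv_comm₀ (by norm_num) (Real.exp_pos _)]
  exact lt_trans Real.exp_one_lt_d9 (by norm_num)

theorem one_sub_pow_le_exp_neg_one {N : ℕ} {π : ℝ} (hπ : π ≤ 1) (h : 1 ≤ N * π) :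
    (1 - π) ^ N ≤ 37 / 100 := by
  calc (1 - π) ^ N ≤ Real.exp (-π) ^ N := by
        gcongr
        linarith [Real.add_one_le_exp (-π)]
    _ = Real.exp (-(N * π)) := by rw [← Real.exp_nat_mul]; ring_nf
    _ ≤ Real.exp (-1) := Real.exp_le_exp.2 (by linarith)
    _ ≤ _ := exp_neg_one_lt.le

/-- With N = K + 1 the sum is (1 - π)^K (1 + Kπ), and by Bernoulli this is at least 1 - (Kπ)² ≥ 3/4.
It is the probability of at most one sender among `N`. -/
theorem three_quarters_le {N : ℕ} (hN : 1 ≤ N) {π : ℝ} (hπ : 0 ≤ π) (h : N * π ≤ 1 / 2) :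
    3 / 4 ≤ (1 - π) ^ N + N * π * (1 - π) ^ (N - 1) := by
  obtain ⟨K, rfl⟩ := Nat.exists_eq_add_of_le' hN
  push_cast at h ⊢
  have hK : (K : ℝ) * π ≤ 1 / 2 := by nlinarith
  have hK0 : 0 ≤ (K : ℝ) * π := by positivity
  have hπ2 : π ≤ 1 / 2 := by nlinarith
  have h1 : 1 - K * π ≤ (1 - π) ^ K := by
    have := one_add_mul_le_pow (a := -π) (by linarith) K
    calc 1 - K * π = 1 + K * -π := by ring
      _ ≤ _ := this
      _ = _ := by ring
  have h2 : (1 - π) ^ (K + 1) + (K + 1) * π * (1 - π) ^ K = (1 - π) ^ K * (1 + K * π) := by ring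
  rw [h2]
  have h3 : (1 - K * π) * (1 + K * π) ≤ (1 - π) ^ K * (1 + K * π) := by gcongr
  nlinarith

/-- The base is the inverse of 1 + 1/(M - 1), and (1 + 1/K)^K ≤ e. -/
theorem lt_one_sub_inv_pow {M : ℕ} (hM : 2 ≤ M) : 36 / 100 < (1 - 1 / (M : ℝ)) ^ (M - 1) := by
  obtain ⟨K, rfl⟩ := Nat.exists_eq_add_of_le' (Nat.le_of_succ_le hM)
  have hK : 0 < (K : ℝ) := by
    have : 0 < K := by omega
    exact_mod_cast this
  refine lt_exp_neg_one.trans_le ?_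
  have h1 : (1 - 1 / ((K + 1 : ℕ) : ℝ)) = (1 + 1 / (K : ℝ))⁻¹ := by
    push_cast
    field_simp
    ring
  rw [h1, Nat.add_sub_cancel, inv_pow, Real.exp_neg]
  gcongr
  calc (1 + 1 / (K : ℝ)) ^ K ≤ Real.exp (1 / K) ^ K := by
        gcongr
        linarith [Real.add_one_le_exp (1 / (K : ℝ))]
    _ = Real.exp 1 := by rw [← Real.exp_nat_mul]; congr 1; field_simp

/-- The expected potential decreases in every phase. -/
theorem walk_step {N W p : ℕ} (hN : 1 ≤ N) (hNW : N < 2 ^ W) (hp : p < W) :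
    (1 - 1 / 2 ^ (p + 1) : ℝ) ^ N * pot (Nat.log 2 N) (p - 1) +
      (1 - (1 - 1 / 2 ^ (p + 1) : ℝ) ^ N -
        N * (1 / 2 ^ (p + 1)) * (1 - 1 / 2 ^ (p + 1)) ^ (N - 1)) *
        pot (Nat.log 2 N) (min (p + 1) (W - 1)) ≤ 985 / 1000 * pot (Nat.log 2 N) p := by
  set a := Nat.log 2 N with ha
  have ha1 : 2 ^ a ≤ N := Nat.pow_log_le_self 2 (by omega)
  have ha2 : N < 2 ^ (a + 1) := Nat.lt_pow_succ_log_self (by norm_num) N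
  have haW : a < W := (Nat.pow_lt_pow_iff_right (by norm_num : 1 < 2)).1 (ha1.trans_lt hNW)
  set π : ℝ := 1 / 2 ^ (p + 1) with hπ
  have hπ0 : 0 < π := by positivity
  have hπ1 : π ≤ 1 / 2 := by
    rw [hπ, pow_succ]
    have : (1 : ℝ) ≤ 2 ^ p := one_le_pow₀ (by norm_num)
    rw [div_le_div_iff₀ (by positivity) (by norm_num)]
    linarith
  set s := (1 - π) ^ N with hs
  set m := N * π * (1 - π) ^ (N - 1) with hm
  have hs0 : 0 ≤ s := pow_nonneg (by linarith) _
  have hm0 : 0 ≤ m := mul_nonneg (by positivity) (pow_nonneg (by linarith) _)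
  have hsm : s + m ≤ 1 := by
    obtain ⟨K, rfl⟩ := Nat.exists_eq_add_of_le' hN
    have h2 : s + m = (1 - π) ^ K * (1 + K * π) := by
      rw [hs, hm, Nat.add_sub_cancel]; push_cast; ring
    rw [h2]
    calc (1 - π) ^ K * (1 + K * π) ≤ (1 - π) ^ K * (1 + π) ^ K := by
          gcongr
          · exact pow_nonneg (by linarith) _
          · exact one_add_mul_le_pow (by linarith) K
      _ = ((1 - π) * (1 + π)) ^ K := (mul_pow _ _ _).symm
      _ ≤ 1 := pow_le_one₀ (by nlinarith) (by nlinarith)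
  have hP := pot_pos a p
  have ha1' : (2 : ℝ) ^ a ≤ N := by exact_mod_cast ha1
  have ha2' : (N : ℝ) < 2 ^ (a + 1) := by exact_mod_cast ha2
  have hNπ : (N : ℝ) * π = N / 2 ^ (p + 1) := by rw [hπ]; ring
  -- Below the target silence, the wrong direction, has probability at most 0.37. At the target
  -- every move is bad, but a message ends the walk with probability at least 0.18. Above the target
  -- noise has probability at most 1/4. The second case gives the constant: 6/5 · 0.82 = 0.984.
  rcases lt_trichotomy p a with h | h | h
  · have e1 : pot a (p - 1) ≤ 6 / 5 * pot a p := pot_le_of_le_succ (by omega)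
    have e2 : pot a (min (p + 1) (W - 1)) = 5 / 6 * pot a p := pot_of_succ_eq (by omega)
    have e3 : s ≤ 37 / 100 := by
      refine one_sub_pow_le_exp_neg_one (by linarith) ?_
      rw [hNπ, le_div_iff₀ (by positivity), one_mul]
      exact le_trans (pow_le_pow_right₀ (by norm_num) h) ha1'
    rw [e2]
    calc s * pot a (p - 1) + (1 - s - m) * (5 / 6 * pot a p)
        ≤ s * (6 / 5 * pot a p) + (1 - s) * (5 / 6 * pot a p) :=
          add_le_add (mul_le_mul_of_nonneg_left e1 hs0)
            (mul_le_mul_of_nonneg_right (by linarith) (by positivity))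
      _ = (5 / 6 + 11 / 30 * s) * pot a p := by ring
      _ ≤ _ := by gcongr; linarith
  · have e1 : pot a (p - 1) ≤ 6 / 5 * pot a p := pot_le_of_le_succ (by omega)
    have e2 : pot a (min (p + 1) (W - 1)) ≤ 6 / 5 * pot a p := pot_le_of_le_succ (by omega)
    have e3 : 18 / 100 ≤ m := by
      have f1 : 1 / 2 ≤ (N : ℝ) * π := by
        rw [hNπ, h, le_div_iff₀ (by positivity), pow_succ]
        linarith
      have f2 : 36 / 100 < (1 - π) ^ (2 ^ (p + 1) - 1) := by
        have := lt_one_sub_inv_pow (M := 2 ^ (p + 1))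
          (by rw [pow_succ]; have := Nat.one_le_two_pow (n := p); omega)
        push_cast at this
        exact this
      have f3 : (1 - π) ^ (2 ^ (p + 1) - 1) ≤ (1 - π) ^ (N - 1) :=
        pow_le_pow_of_le_one (by linarith) (by linarith) (by rw [h]; omega)
      calc (18 / 100 : ℝ) = 1 / 2 * (36 / 100) := by norm_num
        _ ≤ N * π * (1 - π) ^ (N - 1) := by
          gcongr
          exact f2.le.trans f3
    calc s * pot a (p - 1) + (1 - s - m) * pot a (min (p + 1) (W - 1))
        ≤ s * (6 / 5 * pot a p) + (1 - s - m) * (6 / 5 * pot a p) := by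
          gcongr
          linarith
      _ = 6 / 5 * (1 - m) * pot a p := by ring
      _ ≤ _ := by gcongr; linarith
  · have e1 : pot a (p - 1) = 5 / 6 * pot a p := pot_of_succ_eq (by omega)
    have e2 : pot a (min (p + 1) (W - 1)) ≤ 6 / 5 * pot a p := pot_le_of_le_succ (by omega)
    have e3 : 3 / 4 ≤ s + m := by
      refine three_quarters_le hN hπ0.le ?_
      rw [hNπ, div_le_iff₀ (by positivity), pow_succ]
      have : (2 : ℝ) ^ (a + 1) ≤ 2 ^ p := pow_le_pow_right₀ (by norm_num) h
      linarith
    rw [e1]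
    calc s * (5 / 6 * pot a p) + (1 - s - m) * pot a (min (p + 1) (W - 1))
        ≤ s * (5 / 6 * pot a p) + (1 - s - m) * (6 / 5 * pot a p) := by
          gcongr
          linarith
      _ = (5 / 6 * s + 6 / 5 * (1 - s - m)) * pot a p := by ring
      _ ≤ _ := by gcongr; linarith

/-! ### What a listener hears -/

section hear

variable {V : Type*} [Fintype V] (G : SimpleGraph V) (a : V → Act) (v : V)

theorem mem_senders {u : V} : u ∈ senders G a v ↔ G.Adj v u ∧ ∃ m, a u = Act.send m := by
  simp [senders]

theorem hearCD_of_empty (h : senders G a v = ∅) : hearCD G a v = Feedback.silence := by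
  rw [hearCD, if_pos h]

theorem hearCD_of_singleton {u : V} {m : Msg} (h : senders G a v = {u}) (hm : a u = Act.send m) :
    hearCD G a v = Feedback.message m := by
  classical
  have h' : ∃ m u, senders G a v = {u} ∧ a u = Act.send m := ⟨m, u, h, hm⟩
  rw [hearCD, if_neg (by rw [h]; simp), dif_pos h']
  obtain ⟨u', hu', hm'⟩ := h'.choose_spec
  have : u' = u := by
    rw [h] at hu'
    exact (singleton_injective hu').symm
  rw [this, hm] at hm'
  rw [Act.send.inj hm']

theorem hearCD_of_two {u u' : V} (hu : u ∈ senders G a v) (hu' : u' ∈ senders G a v)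
    (hne : u ≠ u') : hearCD G a v = Feedback.noise := by
  classical
  rw [hearCD, if_neg (Finset.ne_empty_of_mem hu), dif_neg]
  rintro ⟨m, w, hw, -⟩
  rw [hw, mem_singleton] at hu hu'
  exact hne (hu.trans hu'.symm)

theorem hearCD_eq_silence_iff : hearCD G a v = Feedback.silence ↔ senders G a v = ∅ := by
  classical
  refine ⟨fun h => ?_, hearCD_of_empty G a v⟩
  rw [hearCD] at h
  split_ifs at h with h1
  exact h1

theorem hearCD_ne_nothing : hearCD G a v ≠ Feedback.nothing := by
  classical
  rw [hearCD]
  split_ifs <;> simp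

theorem exists_of_hearCD_eq_message {m : Msg} (h : hearCD G a v = Feedback.message m) :
    ∃ u, senders G a v = {u} ∧ a u = Act.send m := by
  classical
  rw [hearCD] at h
  split_ifs at h with h1 h2
  have := h2.choose_spec
  rwa [Feedback.message.inj h] at this

end hear

end Radio

namespace Radio

open Finset

/-! ### Exchanges between senders and receivers -/

/-- The random data of a device in a macro-step: a delay and the choice of a slot. -/
abbrev Sample (d W : ℕ) : Type := Fin d × Fin (2 ^ W)

/-- The slot chosen by `y` is `j`; this has probability `2 ^ (-(j + 1))`. -/
def Chooses (W : ℕ) (y : Fin (2 ^ W)) (j : ℕ) : Prop :=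
  2 ^ (W - 1 - j) ≤ y.val ∧ y.val < 2 * 2 ^ (W - 1 - j)

instance (W : ℕ) (y : Fin (2 ^ W)) (j : ℕ) : Decidable (Chooses W y j) := by
  unfold Chooses
  infer_instance

/-- `Chooses` fixes the position of the leading binary digit of `y`, so a sender is active in at
most one slot of a phase (in none if `y = 0`). -/
theorem Chooses.unique {W : ℕ} {y : Fin (2 ^ W)} {i j : ℕ} (hi : i < W) (hj : j < W)
    (h : Chooses W y i) (h' : Chooses W y j) : i = j := by
  by_contra hne
  rcases Nat.lt_or_gt_of_ne hne with hlt | hlt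
  · have : 2 * 2 ^ (W - 1 - j) ≤ 2 ^ (W - 1 - i) := by
      rw [← pow_succ']
      exact Nat.pow_le_pow_right (by norm_num) (by omega)
    have := h.1
    have := h'.2
    omega
  · have : 2 * 2 ^ (W - 1 - i) ≤ 2 ^ (W - 1 - j) := by
      rw [← pow_succ']
      exact Nat.pow_le_pow_right (by norm_num) (by omega)
    have := h'.1
    have := h.2
    omega

theorem avg_chooses {d W j : ℕ} [NeZero d] (hj : j < W) :
    avg (fun x : Sample d W => if Chooses W x.2 j then (1 : ℝ) else 0) = 1 / 2 ^ (j + 1) := by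
  rw [avg_prod_snd (fun y : Fin (2 ^ W) => if Chooses W y j then (1 : ℝ) else 0), avg_eq]
  have h1 : (∑ y : Fin (2 ^ W), if Chooses W y j then (1 : ℝ) else 0) = 2 ^ (W - 1 - j) := by
    have h0 : ∀ y : Fin (2 ^ W), (if Chooses W y j then (1 : ℝ) else 0) =
        (fun y : ℕ => if 2 ^ (W - 1 - j) ≤ y ∧ y < 2 * 2 ^ (W - 1 - j) then (1 : ℝ) else 0) y :=
      fun y => by simp only [Chooses]
    simp only [h0]
    rw [Fin.sum_univ_eq_sum_range (fun y => if 2 ^ (W - 1 - j) ≤ y ∧ y < 2 * 2 ^ (W - 1 - j)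
      then (1 : ℝ) else 0), ← sum_filter, sum_const, nsmul_one]
    have : (range (2 ^ W)).filter (fun y => 2 ^ (W - 1 - j) ≤ y ∧ y < 2 * 2 ^ (W - 1 - j)) =
        Ico (2 ^ (W - 1 - j)) (2 * 2 ^ (W - 1 - j)) := by
      ext y
      simp only [mem_filter, mem_range, mem_Ico, and_iff_right_iff_imp]
      rintro ⟨-, h⟩
      refine h.trans_le ?_
      rw [← pow_succ']
      exact Nat.pow_le_pow_right (by norm_num) (by omega)
    rw [this, Nat.card_Ico, two_mul, Nat.add_sub_cancel]
    push_cast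
    rfl
  rw [h1, Fintype.card_fin]
  push_cast
  rw [div_eq_div_iff (by positivity) (by positivity), one_mul, ← pow_add]
  congr 1
  omega

/-- The listening state in an exchange: idle, walking, or done. -/
abbrev Scratch : Type := Option (ℕ ⊕ Msg)

/-- An exchange: devices in certain states send, others want to receive. -/
structure Exchange (μ : Type) : Type where
  /-- the message to be sent -/
  tx : μ → Option Msg
  /-- the device wants to receive -/
  rx : μ → Bool
  /-- the new state, given the result -/
  fin : μ → Scratch → μ

/-- Start the walk if there is a sender. -/
def walkStart : Feedback → Scratch
  | Feedback.noise => some (Sum.inl 0)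
  | Feedback.message _ => some (Sum.inl 0)
  | _ => none

/-- A step of the walk. -/
def walkNext (W p : ℕ) : Feedback → Scratch
  | Feedback.silence => some (Sum.inl (p - 1))
  | Feedback.noise => some (Sum.inl (min (p + 1) (W - 1)))
  | Feedback.message m => some (Sum.inr m)
  | Feedback.nothing => some (Sum.inl p)

namespace Exchange

variable {μ : Type} (E : Exchange μ)

/-- All senders send in the first slot, and receivers listen. -/
def detect (d W : ℕ) : Step (μ × Scratch) (Sample d W) where
  plan st _ j :=
    if j = 0 then
      match E.tx st.1 with
      | some m => Act.send m
      | none => if E.rx st.1 then Act.listen else Act.idle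
    else Act.idle
  upd st _ fb :=
    (st.1, match E.tx st.1 with
      | some _ => none
      | none => if E.rx st.1 then walkStart (fb 0) else none)

/-- Senders send in a random slot, and walking receivers listen once. -/
def phase (d W : ℕ) : Step (μ × Scratch) (Sample d W) where
  plan st x j :=
    match E.tx st.1 with
    | some m => if Chooses W x.2 j then Act.send m else Act.idle
    | none =>
      match st.2 with
      | some (Sum.inl p) => if j = p then Act.listen else Act.idle
      | _ => Act.idle
  upd st _ fb :=
    (st.1, match st.2 with
      | some (Sum.inl p) => walkNext W p (fb p)
      | q => q)

/-- Local computation at the end of an exchange. -/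
def conclude (d W : ℕ) : Step (μ × Scratch) (Sample d W) where
  plan _ _ _ := Act.idle
  upd st _ _ := (E.fin st.1 st.2, none)

/-- The program of an exchange with `T` phases. -/
def prog (d W T : ℕ) : List (Step (μ × Scratch) (Sample d W)) :=
  E.detect d W :: (List.replicate T (E.phase d W) ++ [E.conclude d W])

theorem length_prog (d W T : ℕ) : (E.prog d W T).length = T + 2 := by
  simp [prog]

/-! ### Correctness of an exchange -/

section

variable {V : Type*} [Fintype V] (G : SimpleGraph V) (M : V → μ)

/-- A receiver with at least one sending neighbor. -/
def Engaged (v : V) : Prop :=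
  E.tx (M v) = none ∧ E.rx (M v) = true ∧ ∃ u, G.Adj v u ∧ E.tx (M u) ≠ none

open Classical in
/-- The sending neighbors. -/
noncomputable def sources (v : V) : Finset V :=
  univ.filter fun u => G.Adj v u ∧ E.tx (M u) ≠ none

/-- A possible listening state during the exchange. -/
def Possible (W : ℕ) (v : V) : Scratch → Prop
  | none => ¬ E.Engaged G M v
  | some (Sum.inl p) => E.Engaged G M v ∧ p < W
  | some (Sum.inr m) => E.Engaged G M v ∧ ∃ u, G.Adj v u ∧ E.tx (M u) = some m

/-- The configuration is a possible one during the exchange. -/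
def Tracks (W : ℕ) (c : V → μ × Scratch) : Prop :=
  ∀ v, (c v).1 = M v ∧ E.Possible G M W v (c v).2

variable {G M} {W d : ℕ}

theorem mem_sources {u v : V} : u ∈ E.sources G M v ↔ G.Adj v u ∧ E.tx (M u) ≠ none := by
  simp [sources]

theorem one_le_card_sources {v : V} (h : E.Engaged G M v) : 1 ≤ (E.sources G M v).card := by
  obtain ⟨u, hu⟩ := h.2.2
  exact card_pos.2 ⟨u, E.mem_sources.2 hu⟩

/-- Collision detection makes this deterministic: a listener hears silence exactly if it has no
sending neighbor. -/
theorem detect_next (hW : 0 < W) (c : V → μ × Scratch) (x : V → Sample d W) (v : V) :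
    let c' := (E.detect d W).next W G c x
    let M := fun u => (c u).1
    (c' v).1 = M v ∧ (E.Engaged G M v → (c' v).2 = some (Sum.inl 0)) ∧
      (¬ E.Engaged G M v → (c' v).2 = none) := by
  intro c' M
  refine ⟨rfl, ?_⟩
  have e : (c' v).2 = match E.tx (M v) with
      | some _ => none
      | none => if E.rx (M v) then walkStart ((E.detect d W).hear W G c x v 0) else none := rfl
  rw [e]
  cases htx : E.tx (M v) with
  | some m => simp [Engaged, htx]
  | none =>
    cases hrx : E.rx (M v) with
    | false => simp [Engaged, hrx]
    | true =>
      have h1 : (E.detect d W).hear W G c x v 0 =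
          hearCD G (fun u => (E.detect d W).plan (c u) (x u) 0) v := by
        have htx' : E.tx (c v).1 = none := htx
        have hrx' : E.rx (c v).1 = true := hrx
        simp [Step.hear, hW, feedbackCD, detect, htx', hrx']
      rw [h1]
      have h2 : ∀ u, (∃ m, (E.detect d W).plan (c u) (x u) 0 = Act.send m) ↔ E.tx (M u) ≠ none := by
        intro u
        simp only [detect, if_true, M]
        cases E.tx (c u).1 with
        | some m => simp
        | none => cases E.rx (c u).1 <;> simp
      have h3 : hearCD G (fun u => (E.detect d W).plan (c u) (x u) 0) v = Feedback.silence ↔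
          ¬ E.Engaged G M v := by
        rw [hearCD_eq_silence_iff, Finset.eq_empty_iff_forall_notMem]
        simp only [mem_senders, h2, Engaged, htx, hrx, true_and, not_exists]
      have h4 := hearCD_ne_nothing G (fun u => (E.detect d W).plan (c u) (x u) 0) v
      generalize hearCD G (fun u => (E.detect d W).plan (c u) (x u) 0) v = fb at h3 h4
      cases fb <;> simp_all [walkStart]

theorem detect_tracks (hW : 0 < W) (c : V → μ × Scratch) (x : V → Sample d W) :
    E.Tracks G (fun u => (c u).1) W ((E.detect d W).next W G c x) := by
  intro v
  have h := E.detect_next (G := G) hW c x v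
  refine ⟨h.1, ?_⟩
  by_cases hE : E.Engaged G (fun u => (c u).1) v
  · rw [h.2.1 hE]
    exact ⟨hE, hW⟩
  · rw [h.2.2 hE]
    exact hE

theorem phase_plan_eq_send {c : V → μ × Scratch} (hc : E.Tracks G M W c) (x : V → Sample d W)
    (u : V) (j : ℕ) (m : Msg) : (E.phase d W).plan (c u) (x u) j = Act.send m ↔
      E.tx (M u) = some m ∧ Chooses W (x u).2 j := by
  simp only [phase, (hc u).1]
  cases E.tx (M u) with
  | some m' =>
    simp only [Option.some.injEq]
    split_ifs with h <;> simp [h]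
  | none =>
    rcases (c u).2 with _ | p | m'
    · simp
    · simp only [reduceCtorEq, false_and, iff_false]
      split_ifs <;> simp
    · simp

theorem mem_senders_phase {c : V → μ × Scratch} (hc : E.Tracks G M W c) (x : V → Sample d W)
    (u v : V) (j : ℕ) : u ∈ senders G (fun u => (E.phase d W).plan (c u) (x u) j) v ↔
      u ∈ E.sources G M v ∧ Chooses W (x u).2 j := by
  simp only [mem_senders, E.phase_plan_eq_send hc, mem_sources, exists_and_right,
    ← Option.ne_none_iff_exists', and_assoc]

theorem hear_phase {c : V → μ × Scratch} (hc : E.Tracks G M W c) (x : V → Sample d W) {v : V}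
    {p : ℕ} (hp : (c v).2 = some (Sum.inl p)) : (E.phase d W).hear W G c x v p =
      hearCD G (fun u => (E.phase d W).plan (c u) (x u) p) v := by
  have h := hc v
  rw [hp] at h
  obtain ⟨h1, h2, h3⟩ := h
  have htx : E.tx (c v).1 = none := by rw [h1]; exact h2.1
  simp [Step.hear, h3, feedbackCD, phase, htx, hp]

theorem phase_tracks {c : V → μ × Scratch} (hc : E.Tracks G M W c) (x : V → Sample d W) :
    E.Tracks G M W ((E.phase d W).next W G c x) := by
  intro v
  refine ⟨(hc v).1, ?_⟩
  have h := (hc v).2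
  have e : ((E.phase d W).next W G c x v).2 = match (c v).2 with
      | some (Sum.inl p) => walkNext W p ((E.phase d W).hear W G c x v p)
      | q => q := rfl
  rw [e]
  rcases hq : (c v).2 with _ | p | m
  · rwa [hq] at h
  · rw [hq] at h
    obtain ⟨h1, h2⟩ := h
    simp only
    rw [E.hear_phase hc x hq]
    rcases hfb : hearCD G (fun u => (E.phase d W).plan (c u) (x u) p) v with _ | _ | _ | m
    · exact ⟨h1, h2⟩
    · exact ⟨h1, by omega⟩
    · exact ⟨h1, by omega⟩
    · obtain ⟨u, hu, hm⟩ := exists_of_hearCD_eq_message _ _ _ hfb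
      have hmem := (E.mem_senders_phase hc x u v p).1 (by rw [hu]; exact mem_singleton_self u)
      exact ⟨h1, u, (E.mem_sources.1 hmem.1).1, ((E.phase_plan_eq_send hc x u p m).1 hm).1⟩
  · rwa [hq] at h

/-- The potential of a receiver. -/
noncomputable def recvPot (G : SimpleGraph V) (M : V → μ) (v : V) (c : V → μ × Scratch) : ℝ :=
  match (c v).2 with
  | some (Sum.inl p) => pot (Nat.log 2 (E.sources G M v).card) p
  | _ => 0

theorem recvPot_nonneg (v : V) (c : V → μ × Scratch) : 0 ≤ E.recvPot G M v c := by
  rw [recvPot]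
  split
  · exact (pot_pos _ _).le
  · exact le_rfl

/-- Given the configuration, distinct senders choose slots independently, so silence and reception
have the binomial probabilities of `walk_step`. -/
theorem wp_phase_le [NeZero d] {c : V → μ × Scratch} (hc : E.Tracks G M W c) {v : V}
    (hv : (E.sources G M v).card < 2 ^ W) :
    avg (fun x : V → Sample d W => E.recvPot G M v ((E.phase d W).next W G c x)) ≤
      985 / 1000 * E.recvPot G M v c := by
  classical
  have h := (hc v).2
  have e : ∀ x : V → Sample d W, ((E.phase d W).next W G c x v).2 = match (c v).2 with
      | some (Sum.inl p) => walkNext W p ((E.phase d W).hear W G c x v p)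
      | q => q := fun x => rfl
  rcases hq : (c v).2 with _ | p | m
  · simp [recvPot, e, hq, avg_const]
  · rw [hq] at h
    obtain ⟨h1, h2⟩ := h
    set S := E.sources G M v with hS
    set a := Nat.log 2 S.card with ha
    have hS1 : 1 ≤ S.card := E.one_le_card_sources h1
    let b : V → Sample d W → ℝ := fun _ y => if Chooses W y.2 p then 1 else 0
    let sil : (V → Sample d W) → ℝ := fun x => ∏ u ∈ S, (1 - b u (x u))
    let msg : (V → Sample d W) → ℝ := fun x =>
      ∑ u ∈ S, ∏ w ∈ S, if w = u then b w (x w) else 1 - b w (x w)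
    have hb : ∀ u, avg (b u) = 1 / 2 ^ (p + 1) := fun u => avg_chooses h2
    have hb' : ∀ u, avg (fun y => 1 - b u y) = 1 - 1 / 2 ^ (p + 1) := by
      intro u
      have := avg_add (fun y => 1 - b u y) (b u)
      simp only [sub_add_cancel, avg_const, hb] at this
      linarith
    have hsil : avg sil = (1 - 1 / 2 ^ (p + 1)) ^ S.card := by
      rw [avg_pi_prod_subset S (fun u y => 1 - b u y)]
      simp only [hb', prod_const]
    have hmsg : avg msg = S.card * (1 / 2 ^ (p + 1)) * (1 - 1 / 2 ^ (p + 1)) ^ (S.card - 1) := by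
      rw [avg_sum]
      have : ∀ u ∈ S, avg (fun x : V → Sample d W => ∏ w ∈ S,
          if w = u then b w (x w) else 1 - b w (x w)) =
          1 / 2 ^ (p + 1) * (1 - 1 / 2 ^ (p + 1)) ^ (S.card - 1) := by
        intro u hu
        rw [avg_pi_prod_subset S (fun w y => if w = u then b w y else 1 - b w y),
          ← mul_prod_erase S _ hu]
        simp only [if_true, hb]
        congr 1
        rw [← card_erase_of_mem hu, ← prod_const]
        refine prod_congr rfl fun w hw => ?_
        simp only [if_neg (ne_of_mem_erase hw), hb']
      rw [sum_congr rfl this, sum_const, nsmul_eq_mul, mul_assoc]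
    -- `sil` and `msg` are the indicators of no sender and of exactly one sender in slot `p`, so `1
    -- - sil - msg` indicates noise. A reception contributes nothing, since a finished walk has
    -- potential 0.
    have key : ∀ x : V → Sample d W, E.recvPot G M v ((E.phase d W).next W G c x) =
        sil x * pot a (p - 1) + (1 - sil x - msg x) * pot a (min (p + 1) (W - 1)) := by
      intro x
      have hmem : ∀ u, u ∈ senders G (fun u => (E.phase d W).plan (c u) (x u) p) v ↔
          u ∈ S ∧ Chooses W (x u).2 p := fun u => E.mem_senders_phase hc x u v p
      have hre : E.recvPot G M v ((E.phase d W).next W G c x) =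
          match walkNext W p (hearCD G (fun u => (E.phase d W).plan (c u) (x u) p) v) with
          | some (Sum.inl p) => pot a p
          | _ => 0 := by
        rw [recvPot, e, hq, ← E.hear_phase hc x hq]
      rw [hre]
      set A := fun u => (E.phase d W).plan (c u) (x u) p with hA
      rcases (senders G A v).eq_empty_or_nonempty with h0 | ⟨u, hu⟩
      · have hno : ∀ u ∈ S, b u (x u) = 0 := by
          intro u hu
          have : u ∉ senders G A v := by rw [h0]; exact notMem_empty u
          rw [hmem] at this
          simp only [b]
          exact if_neg fun hh => this ⟨hu, hh⟩
        have s1 : sil x = 1 := prod_eq_one fun u hu => by rw [hno u hu, sub_zero]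
        have s2 : msg x = 0 := sum_eq_zero fun u hu =>
          prod_eq_zero hu (by rw [if_pos rfl, hno u hu])
        rw [hearCD_of_empty G A v h0, s1, s2]
        simp [walkNext]
      · have hu' := (hmem u).1 hu
        have bu : b u (x u) = 1 := if_pos hu'.2
        have s1 : sil x = 0 := prod_eq_zero hu'.1 (by rw [bu, sub_self])
        by_cases h1' : senders G A v = {u}
        · have hno : ∀ w ∈ S, w ≠ u → b w (x w) = 0 := by
            intro w hw hwu
            have : w ∉ senders G A v := by rw [h1', mem_singleton]; exact hwu
            rw [hmem] at this
            exact if_neg fun hh => this ⟨hw, hh⟩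
          have s2 : msg x = 1 := by
            change (∑ u ∈ S, ∏ w ∈ S, if w = u then b w (x w) else 1 - b w (x w)) = 1
            rw [sum_eq_single_of_mem u hu'.1]
            · refine prod_eq_one fun w hw => ?_
              split_ifs with hwu
              · rw [hwu, bu]
              · rw [hno w hw hwu, sub_zero]
            · intro w hw hwu
              exact prod_eq_zero hu'.1 (by rw [if_neg (Ne.symm hwu), bu, sub_self])
          obtain ⟨m, hm⟩ := ((mem_senders G A v).1 hu).2
          rw [hearCD_of_singleton G A v h1' hm, s1, s2]
          simp [walkNext]
        · obtain ⟨w, hw, hwu⟩ : ∃ w ∈ senders G A v, w ≠ u := by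
            by_contra hcon
            push Not at hcon
            exact h1' (eq_singleton_iff_unique_mem.2 ⟨hu, hcon⟩)
          have hw' := (hmem w).1 hw
          have bw : b w (x w) = 1 := if_pos hw'.2
          have s2 : msg x = 0 := by
            refine sum_eq_zero fun y _ => ?_
            by_cases hy : y = u
            · exact prod_eq_zero hw'.1 (by rw [if_neg (by rw [hy]; exact hwu), bw, sub_self])
            · exact prod_eq_zero hu'.1 (by rw [if_neg (Ne.symm hy), bu, sub_self])
          rw [hearCD_of_two G A v hw hu hwu, s1, s2]
          simp [walkNext]
    have hr : E.recvPot G M v c = pot a p := by rw [recvPot, hq]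
    calc avg (fun x : V → Sample d W => E.recvPot G M v ((E.phase d W).next W G c x))
        = avg (fun x => pot a (p - 1) * sil x + (pot a (min (p + 1) (W - 1)) +
            (-pot a (min (p + 1) (W - 1)) * sil x + -pot a (min (p + 1) (W - 1)) * msg x))) := by
          congr 1
          funext x
          rw [key]
          ring
      _ = avg sil * pot a (p - 1) + (1 - avg sil - avg msg) * pot a (min (p + 1) (W - 1)) := by
          rw [avg_add, avg_add, avg_add, avg_const_mul, avg_const_mul, avg_const_mul, avg_const]
          ring
      _ ≤ _ := by
          rw [hsil, hmsg, hr]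
          exact walk_step hS1 hv h2
  · simp [recvPot, e, hq, avg_const]

theorem wp_phases_le [NeZero d] {c : V → μ × Scratch} (hc : E.Tracks G M W c) {v : V}
    (hv : (E.sources G M v).card < 2 ^ W) (T : ℕ) :
    wp W G (List.replicate T (E.phase d W)) (E.recvPot G M v) c ≤
      (985 / 1000) ^ T * E.recvPot G M v c := by
  induction T generalizing c with
  | zero => simp [wp]
  | succ T ih =>
    calc _ = avg fun x => wp W G (List.replicate T (E.phase d W)) (E.recvPot G M v)
          ((E.phase d W).next W G c x) := rfl
      _ ≤ avg fun x : V → Sample d W => (985 / 1000) ^ T *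
          E.recvPot G M v ((E.phase d W).next W G c x) :=
        avg_mono fun x => ih (E.phase_tracks hc x)
      _ ≤ (985 / 1000) ^ T * (985 / 1000 * E.recvPot G M v c) := by
        rw [avg_const_mul]
        gcongr
        exact E.wp_phase_le hc hv
      _ = _ := by ring

/-- The configuration after the exchange, if the listening states are `q`. -/
def result (M : V → μ) (q : V → Scratch) (v : V) : μ × Scratch := (E.fin (M v) (q v), none)

/-- An exchange fails only with small probability. -/
theorem wp_prog_le [NeZero d] (hW : 0 < W) (T : ℕ) (c : V → μ × Scratch)
    (hdeg : ∀ v, (E.sources G (fun u => (c u).1) v).card < 2 ^ W)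
    {f : (V → μ × Scratch) → ℝ} {B F : ℝ} (hB : 0 ≤ B) (hF : 0 ≤ F)
    (hgood : ∀ q : V → Scratch, (∀ v, E.Possible G (fun u => (c u).1) W v (q v)) →
      (∀ v p, q v ≠ some (Sum.inl p)) → f (E.result (fun u => (c u).1) q) ≤ B)
    (hall : ∀ q : V → Scratch, (∀ v, E.Possible G (fun u => (c u).1) W v (q v)) →
      f (E.result (fun u => (c u).1) q) ≤ F) :
    wp W G (E.prog d W T) f c ≤
      B + F * ((985 / 1000) ^ T * (Fintype.card V : ℝ) ^ 2) := by
  classical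
  set M := fun u => (c u).1 with hM
  change avg (fun x => wp W G (List.replicate T (E.phase d W) ++ [E.conclude d W]) f
    ((E.detect d W).next W G c x)) ≤ _
  refine avg_le_const fun x => ?_
  set c₁ := (E.detect d W).next W G c x with hc₁
  have htr : E.Tracks G M W c₁ := E.detect_tracks hW c x
  rw [wp_append]
  have h1 : wp W G (List.replicate T (E.phase d W)) (wp W G [E.conclude d W] f) c₁ ≤
      wp W G (List.replicate T (E.phase d W))
        (fun c => B + F * ∑ v, E.recvPot G M v c) c₁ := by
    refine wp_mono_of_invariant (Inv := E.Tracks G M W) ?_ ?_ htr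
    · intro S hS c x hc
      rw [List.eq_of_mem_replicate hS]
      exact E.phase_tracks hc x
    · intro c₂ hc₂
      have h2 : wp W G [E.conclude d W] f c₂ = f (E.result M fun v => (c₂ v).2) := by
        change avg (fun x : V → Sample d W => f ((E.conclude d W).next W G c₂ x)) = _
        have : ∀ x : V → Sample d W, (E.conclude d W).next W G c₂ x =
            E.result M fun v => (c₂ v).2 := by
          intro x
          funext v
          simp only [Step.next, conclude, result, (hc₂ v).1]
        simp only [this, avg_const]
      rw [h2]
      have hpos : ∀ v, E.Possible G M W v (c₂ v).2 := fun v => (hc₂ v).2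
      -- Markov's inequality: an unfinished walk has potential at least 1, so the total potential
      -- dominates the indicator of failure.
      by_cases hex : ∃ v p, (c₂ v).2 = some (Sum.inl p)
      · obtain ⟨v, p, hv⟩ := hex
        have h3 : 1 ≤ ∑ v, E.recvPot G M v c₂ := by
          calc (1 : ℝ) ≤ E.recvPot G M v c₂ := by rw [recvPot, hv]; exact one_le_pot _ _
            _ ≤ _ := single_le_sum (f := fun v => E.recvPot G M v c₂)
                (fun v _ => E.recvPot_nonneg v c₂) (mem_univ v)
        have := hall _ hpos
        nlinarith
      · push Not at hex
        have := hgood _ hpos hex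
        have h4 : 0 ≤ ∑ v, E.recvPot G M v c₂ := sum_nonneg fun v _ => E.recvPot_nonneg v c₂
        nlinarith [mul_nonneg hF h4]
  refine h1.trans ?_
  rw [wp_add, wp_const, wp_const_mul, wp_sum]
  gcongr
  calc ∑ v, wp W G (List.replicate T (E.phase d W)) (E.recvPot G M v) c₁
      ≤ ∑ _v : V, (985 / 1000 : ℝ) ^ T * Fintype.card V := by
        refine sum_le_sum fun v _ => (E.wp_phases_le htr (hdeg v) T).trans ?_
        gcongr
        have hd := E.detect_next (G := G) hW c x v
        by_cases hv : E.Engaged G M v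
        · have hc1 : (c₁ v).2 = some (Sum.inl 0) := hd.2.1 hv
          rw [recvPot, hc1]
          simp only [pot, zero_tsub, zero_add, tsub_zero]
          -- The walk starts at 0, so its initial potential is at most the number of senders, hence
          -- at most the number of vertices.
          calc (6 / 5 : ℝ) ^ Nat.log 2 (E.sources G M v).card
              ≤ 2 ^ Nat.log 2 (E.sources G M v).card := by gcongr; norm_num
            _ ≤ (E.sources G M v).card := by
              exact_mod_cast Nat.pow_log_le_self 2
                (by have := E.one_le_card_sources hv; omega)
            _ ≤ _ := by exact_mod_cast card_le_univ _
        · have hc1 : (c₁ v).2 = none := hd.2.2 hv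
          rw [recvPot, hc1]
          positivity
    _ = _ := by
      rw [sum_const, nsmul_eq_mul, card_univ]
      ring

end

/-! ### Energy of an exchange -/

section energy

variable {W d : ℕ}

theorem cost_conclude (st : μ × Scratch) (x : Sample d W) : (E.conclude d W).cost W st x = 0 := by
  simp [Step.cost, conclude]

theorem cost_le_one {σ X : Type} (S : Step σ X) (st : σ) (x : X)
    (h : ∀ i < W, ∀ j < W, S.plan st x i ≠ Act.idle → S.plan st x j ≠ Act.idle → i = j) :
    S.cost W st x ≤ 1 := by
  classical
  rw [Step.cost, card_le_one]
  intro i hi j hj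
  rw [mem_filter, mem_range] at hi hj
  exact h i hi.1 j hj.1 hi.2 hj.2

theorem cost_detect_le (st : μ × Scratch) (x : Sample d W) : (E.detect d W).cost W st x ≤ 1 := by
  refine cost_le_one _ _ _ fun i _ j _ hi hj => ?_
  simp only [detect] at hi hj
  have hi0 : i = 0 := by
    by_contra h
    exact hi (if_neg h)
  have hj0 : j = 0 := by
    by_contra h
    exact hj (if_neg h)
  rw [hi0, hj0]

theorem cost_detect_eq_zero (st : μ × Scratch) (x : Sample d W) (h1 : E.tx st.1 = none)
    (h2 : E.rx st.1 = false) : (E.detect d W).cost W st x = 0 := by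
  simp [Step.cost, detect, h1, h2]

theorem cost_phase_le (st : μ × Scratch) (x : Sample d W) : (E.phase d W).cost W st x ≤ 1 := by
  refine cost_le_one _ _ _ fun i hi j hj hi' hj' => ?_
  simp only [phase] at hi' hj'
  cases htx : E.tx st.1 with
  | some m =>
    simp only [htx] at hi' hj'
    split_ifs at hi' hj' with h1 h2
    · exact h1.unique hi hj h2
    all_goals simp_all
  | none =>
    simp only [htx] at hi' hj'
    rcases hq : st.2 with _ | p | m
    · simp [hq] at hi'
    · simp only [hq] at hi' hj'
      split_ifs at hi' hj' with h1 h2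
      · exact h1.trans h2.symm
      all_goals simp_all
    · simp [hq] at hi'

theorem cost_phase_eq_zero (st : μ × Scratch) (x : Sample d W) (h1 : E.tx st.1 = none)
    (h2 : st.2 = none) : (E.phase d W).cost W st x = 0 := by
  simp [Step.cost, phase, h1, h2]

/-- During the phases a walk neither appears nor vanishes; the equivalence in `hQ` lets later bounds
distinguish receivers that detected nobody. -/
theorem pay_phases (T : ℕ) (m : μ) (q : Scratch) (e : ℕ) (he : T ≤ e)
    {Q : μ × Scratch → ℕ → Prop}
    (hQ : ∀ q' e', (q' = none ↔ q = none) → e - T ≤ e' → Q (m, q') e') :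
    Pay W (List.replicate T (E.phase d W)) (m, q) e Q := by
  induction T generalizing q e with
  | zero => exact hQ q e Iff.rfl (by omega)
  | succ T ih =>
    intro x fb
    have hc := E.cost_phase_le (m, q) x
    refine ⟨by omega, ih _ _ (by omega) fun q' e' h1 h2 => hQ q' e' (h1.trans ?_) (by omega)⟩
    rcases q with _ | p | m'
    · exact Iff.rfl
    · simp only
      cases fb p <;> simp [walkNext]
    · simp

theorem pay_phases_idle (T : ℕ) (m : μ) (e : ℕ) (htx : E.tx m = none)
    {Q : μ × Scratch → ℕ → Prop} (hQ : Q (m, none) e) :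
    Pay W (List.replicate T (E.phase d W)) (m, none) e Q := by
  induction T with
  | zero => exact hQ
  | succ T ih =>
    intro x fb
    rw [E.cost_phase_eq_zero (m, none) x htx rfl]
    exact ⟨Nat.zero_le _, ih⟩

/-- The energy of an exchange: senders and receivers that hear something pay `T + 1`, receivers
that hear nothing pay `1`. -/
theorem pay_prog (T : ℕ) (m : μ) (q : Scratch) (e : ℕ) {Q : μ × Scratch → ℕ → Prop}
    (htx : E.tx m ≠ none → T + 1 ≤ e ∧ ∀ e', e - (T + 1) ≤ e' → Q (E.fin m none, none) e')
    (hrx : E.tx m = none → E.rx m = true → T + 1 ≤ e ∧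
      (∀ e', e - 1 ≤ e' → Q (E.fin m none, none) e') ∧
      ∀ q' e', q' ≠ none → e - (T + 1) ≤ e' → Q (E.fin m q', none) e')
    (hidle : E.tx m = none → E.rx m = false → Q (E.fin m none, none) e) :
    Pay W (E.prog d W T) (m, q) e Q := by
  intro x fb
  rw [Pay_append]
  have hcon : ∀ st e', Q (E.fin st.1 st.2, none) e' → Pay W [E.conclude d W] st e' Q := by
    intro st e' h x fb
    rw [E.cost_conclude]
    exact ⟨Nat.zero_le _, h⟩
  have hc := E.cost_detect_le (m, q) x
  have hc0 := E.cost_detect_eq_zero (m, q) x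
  generalize (E.detect d W).cost W (m, q) x = k at hc hc0 ⊢
  cases h : E.tx m with
  | some μ' =>
    obtain ⟨h1, h2⟩ := htx (by simp [h])
    refine ⟨by omega, ?_⟩
    simp only [detect, h]
    refine E.pay_phases T m none _ (by omega) fun q' e' hq' he' => hcon _ _ ?_
    rw [hq'.2 rfl]
    exact h2 _ (by omega)
  | none =>
    cases h' : E.rx m with
    | false =>
      rw [hc0 h h']
      refine ⟨Nat.zero_le _, ?_⟩
      simp only [detect, h, h']
      exact E.pay_phases_idle T m e h (hcon _ _ (hidle h h'))
    | true =>
      obtain ⟨h1, h2, h3⟩ := hrx h h'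
      refine ⟨by omega, ?_⟩
      simp only [detect, h, h', if_true]
      by_cases hw : walkStart (fb 0) = none
      · rw [hw]
        exact E.pay_phases_idle T m _ h (hcon _ _ (h2 _ (by omega)))
      · refine E.pay_phases T m _ _ (by omega) fun q' e' hq' he' => hcon _ _ ?_
        exact h3 _ _ (fun hq => hw (hq'.1 hq)) (by omega)

end energy

end Exchange

end Radio

namespace Radio

open Finset

/-! ### Good labelings -/

section labeling

variable {V : Type*} {G : SimpleGraph V}

/-- Every vertex with a positive label has a neighbor whose label is smaller by one. -/
def GoodLabeling (G : SimpleGraph V) (lab : V → ℕ) : Prop :=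
  ∀ v, lab v ≠ 0 → ∃ u, G.Adj v u ∧ lab u + 1 = lab v

theorem GoodLabeling.exists_eq {lab : V → ℕ} (h : GoodLabeling G lab) (v : V) (i : ℕ)
    (hi : i ≤ lab v) : ∃ u, lab u = i := by
  obtain ⟨j, hj⟩ := Nat.exists_eq_add_of_le hi
  induction j generalizing v with
  | zero => exact ⟨v, hj⟩
  | succ j ih =>
    obtain ⟨u, -, hu⟩ := h v (by omega)
    exact ih u (by omega) (by omega)

/-- Descending from `v` meets every smaller label, so these labels need distinct vertices. This is
why `n` steps upwards and `n` steps downwards suffice in a schedule. -/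
theorem GoodLabeling.lt_card [Fintype V] {lab : V → ℕ} (h : GoodLabeling G lab) (v : V) :
    lab v < Fintype.card V := by
  classical
  have : range (lab v + 1) ⊆ univ.image lab := by
    intro i hi
    obtain ⟨u, hu⟩ := h.exists_eq v i (by simpa [Nat.lt_succ_iff] using hi)
    exact mem_image.2 ⟨u, mem_univ u, hu⟩
  have h1 := card_le_card this
  rw [card_range] at h1
  exact h1.trans card_image_le

open Classical in
/-- A neighbor whose label is smaller by one. -/
noncomputable def parent (G : SimpleGraph V) (lab : V → ℕ) (v : V) : V :=
  if h : ∃ u, G.Adj v u ∧ lab u + 1 = lab v then h.choose else v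

theorem GoodLabeling.parent_spec {lab : V → ℕ} (h : GoodLabeling G lab) {v : V} (hv : lab v ≠ 0) :
    G.Adj v (parent G lab v) ∧ lab (parent G lab v) + 1 = lab v := by
  rw [parent, dif_pos (h v hv)]
  exact (h v hv).choose_spec

/-- The root of the cluster of a vertex. -/
noncomputable def root (G : SimpleGraph V) (lab : V → ℕ) (v : V) : V :=
  (parent G lab)^[lab v] v

theorem root_of_eq_zero {lab : V → ℕ} {v : V} (hv : lab v = 0) : root G lab v = v := by
  rw [root, hv]
  rfl

theorem GoodLabeling.root_parent {lab : V → ℕ} (h : GoodLabeling G lab) {v : V} (hv : lab v ≠ 0) :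
    root G lab (parent G lab v) = root G lab v := by
  rw [root, root, ← (h.parent_spec hv).2]
  rfl

/-- Induction from the roots to the leaves. -/
theorem GoodLabeling.induction {lab : V → ℕ} (h : GoodLabeling G lab) {P : V → Prop}
    (h0 : ∀ v, lab v = 0 → P v) (h1 : ∀ v, lab v ≠ 0 → P (parent G lab v) → P v) (v : V) : P v := by
  obtain ⟨k, hk⟩ : ∃ k, lab v = k := ⟨_, rfl⟩
  induction k generalizing v with
  | zero => exact h0 v hk
  | succ k ih =>
    have := (h.parent_spec (v := v) (by omega)).2
    exact h1 v (by omega) (ih _ (by omega))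

theorem GoodLabeling.lab_root {lab : V → ℕ} (h : GoodLabeling G lab) (v : V) :
    lab (root G lab v) = 0 := by
  induction v using h.induction with
  | h0 v hv => rwa [root_of_eq_zero hv]
  | h1 v hv ih => rwa [← h.root_parent hv]

/-- The graph of the clusters. -/
def clusterGraph (G : SimpleGraph V) (lab : V → ℕ) : SimpleGraph {r : V // lab r = 0} :=
  SimpleGraph.fromRel fun r r' => ∃ u v, G.Adj u v ∧ root G lab u = r ∧ root G lab v = r'

/-- Replacing each vertex of a walk by its root gives a walk between clusters, up to repetitions. -/
theorem GoodLabeling.clusterGraph_connected {lab : V → ℕ} (h : GoodLabeling G lab)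
    (hG : G.Connected) : (clusterGraph G lab).Connected := by
  have key : ∀ u v, (p : G.Walk u v) → (clusterGraph G lab).Reachable
      ⟨root G lab u, h.lab_root u⟩ ⟨root G lab v, h.lab_root v⟩ := by
    intro u v p
    induction p with
    | nil => exact SimpleGraph.Reachable.refl _
    | cons hadj p ih =>
      rename_i a b c
      refine SimpleGraph.Reachable.trans ?_ ih
      by_cases he : root G lab a = root G lab b
      · simp only [he]
        exact SimpleGraph.Reachable.refl _
      · refine SimpleGraph.Adj.reachable ?_
        rw [clusterGraph, SimpleGraph.fromRel_adj]
        exact ⟨fun hh => he (congrArg Subtype.val hh), Or.inl ⟨a, b, hadj, rfl, rfl⟩⟩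
  obtain ⟨v₀⟩ := hG.nonempty
  have : Nonempty {r : V // lab r = 0} := ⟨⟨_, h.lab_root v₀⟩⟩
  refine SimpleGraph.Connected.mk fun r r' => ?_
  obtain ⟨p⟩ := hG.preconnected r.1 r'.1
  have := key _ _ p
  simpa only [root_of_eq_zero r.2, root_of_eq_zero r'.2] using this

end labeling

/-! ### Schedules -/

/-- A device with label `lab` that was reached at time `s` sends at time `k`.  Time is divided into
rounds of length `2 * n`, which consist of the contact step, the steps upwards, the start of new
clusters, and the steps downwards. -/
def SendOK (n k lab s : ℕ) : Prop :=
  (k % (2 * n) = 0 ∧ s / (2 * n) + 1 = k / (2 * n)) ∨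
  (0 < k % (2 * n) ∧ k % (2 * n) < n ∧ lab + k % (2 * n) = n ∧ s / (2 * n) = k / (2 * n)) ∨
  (n < k % (2 * n) ∧ lab + n + 1 = k % (2 * n) ∧ s / (2 * n) = k / (2 * n))

/-- A device with label `lab` that was not yet reached wants to receive at time `k`. -/
def RecvOK (n k lab : ℕ) : Prop :=
  k % (2 * n) = 0 ∨
  (0 < k % (2 * n) ∧ k % (2 * n) < n ∧ lab + 1 + k % (2 * n) = n) ∨
  (n < k % (2 * n) ∧ lab + n = k % (2 * n))

/-- A device with label `lab` that was not yet reached starts a new cluster at time `k`. -/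
def StartOK (n k lab del : ℕ) : Prop :=
  k % (2 * n) = n ∧ lab = 0 ∧ del = k / (2 * n)

instance (n k lab s : ℕ) : Decidable (SendOK n k lab s) := by unfold SendOK; infer_instance
instance (n k lab : ℕ) : Decidable (RecvOK n k lab) := by unfold RecvOK; infer_instance
instance (n k lab del : ℕ) : Decidable (StartOK n k lab del) := by unfold StartOK; infer_instance

/-! ### How fast clusters are reached under the schedule -/

section wave

variable {V : Type*} {G : SimpleGraph V} {n k₀ : ℕ} {lab stamp : V → ℕ}

/-- From time `k₀` on, the times at which the devices are reached obey the schedule. -/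
def Wave (G : SimpleGraph V) (n k₀ : ℕ) (lab stamp : V → ℕ) : Prop :=
  ∀ u v j, k₀ ≤ j → G.Adj u v → stamp u < j → SendOK n j (lab u) (stamp u) → RecvOK n j (lab v) →
    stamp v ≤ j

theorem mul_add_mod_div {R τ ρ : ℕ} (h : ρ < R) : (τ * R + ρ) % R = ρ ∧ (τ * R + ρ) / R = τ := by
  constructor
  · rw [Nat.mul_comm, Nat.mul_add_mod, Nat.mod_eq_of_lt h]
  · rw [Nat.mul_comm, Nat.mul_add_div (by omega), Nat.div_eq_of_lt h, add_zero]

theorem div_eq_of_bounds {R τ s : ℕ} (h1 : τ * R ≤ s) (h2 : s < τ * R + R) : s / R = τ := by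
  obtain ⟨ρ, rfl⟩ := Nat.exists_eq_add_of_le h1
  exact (mul_add_mod_div (by omega)).2

/-- A device sends in the contact step of the round after the one that reached it, and there every
unreached device listens. -/
theorem Wave.contact (h : Wave G n k₀ lab stamp) (hn : 0 < n) {u v : V} (hadj : G.Adj u v) {τ : ℕ}
    (hk : k₀ ≤ 2 * n) (hu : stamp u < τ * (2 * n)) : stamp v ≤ τ * (2 * n) := by
  have h1 : stamp u / (2 * n) < τ := Nat.div_lt_of_lt_mul (by rwa [mul_comm])
  have h2 : (stamp u / (2 * n) + 1) * (2 * n) ≤ τ * (2 * n) := Nat.mul_le_mul_right _ h1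
  refine le_trans ?_ h2
  have h3 := mul_add_mod_div (R := 2 * n) (τ := stamp u / (2 * n) + 1) (ρ := 0) (by omega)
  rw [add_zero] at h3
  refine h u v _ (by rw [Nat.add_mul]; omega) hadj ?_ (Or.inl ⟨h3.1, h3.2.symm⟩) (Or.inl h3.1)
  rw [mul_comm]
  exact Nat.lt_mul_div_succ _ (by omega)

theorem Wave.up (h : Wave G n k₀ lab stamp) {u v : V} (hadj : G.Adj u v)
    (hlab : lab v + 1 = lab u) (hlt : lab u < n) {τ : ℕ} (h1 : τ * (2 * n) ≤ stamp u)
    (h2 : stamp u + lab u < τ * (2 * n) + n) (hk : k₀ ≤ τ * (2 * n) + (n - lab u)) :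
    stamp v + lab u ≤ τ * (2 * n) + n := by
  have h3 := mul_add_mod_div (R := 2 * n) (τ := τ) (ρ := n - lab u) (by omega)
  have h4 : stamp u / (2 * n) = τ := div_eq_of_bounds h1 (by omega)
  have := h u v (τ * (2 * n) + (n - lab u)) hk hadj (by omega)
    (Or.inr (Or.inl (by rw [h3.1, h3.2, h4]; omega)))
    (Or.inr (Or.inl (by rw [h3.1]; omega)))
  omega

theorem Wave.down (h : Wave G n k₀ lab stamp) {u v : V} (hadj : G.Adj u v)
    (hlab : lab u + 1 = lab v) (hlt : lab v < n) {τ : ℕ} (h1 : τ * (2 * n) ≤ stamp u)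
    (h2 : stamp u ≤ τ * (2 * n) + n + lab u) (hk : k₀ ≤ τ * (2 * n) + (n + lab v)) :
    stamp v ≤ τ * (2 * n) + n + lab v := by
  have h3 := mul_add_mod_div (R := 2 * n) (τ := τ) (ρ := n + lab v) (by omega)
  have h4 : stamp u / (2 * n) = τ := div_eq_of_bounds h1 (by omega)
  have := h u v (τ * (2 * n) + (n + lab v)) hk hadj (by omega)
    (Or.inr (Or.inr (by rw [h3.1, h3.2, h4]; omega)))
    (Or.inr (Or.inr (by rw [h3.1]; omega)))
  omega

/-- The bound on `stamp v` says that `v` is reached before its slot for sending upwards; this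
property passes to the parent. If `v` was reached in an earlier round, the parent was reached by
contact instead. Parents serve only the analysis: devices know labels, and reaching further devices
does no harm. -/
theorem Wave.root_le (h : Wave G n k₀ lab stamp) (hlab : GoodLabeling G lab)
    (hn : ∀ v, lab v < n) {τ : ℕ} (hk : k₀ ≤ τ * (2 * n) + 1) (hk' : k₀ ≤ 2 * n) (v : V)
    (hv : stamp v + lab v + 1 ≤ τ * (2 * n) + n) :
    stamp (root G lab v) + 1 ≤ τ * (2 * n) + n := by
  induction v using hlab.induction with
  | h0 v hl => rw [root_of_eq_zero hl]; omega
  | h1 v hl ih =>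
    obtain ⟨hadj, hp⟩ := hlab.parent_spec hl
    have hvn := hn v
    rw [← hlab.root_parent hl]
    refine ih ?_
    rcases lt_or_ge (stamp v) (τ * (2 * n)) with hlt | hge
    · have := h.contact (by omega) hadj hk' hlt
      omega
    · have := h.up hadj hp hvn hge (by omega) (by omega)
      omega

/-- Dually, a parent reached in this round before its downward slot passes the message on, and a
parent reached in an earlier round has already contacted the child. -/
theorem Wave.le_of_root_le (h : Wave G n k₀ lab stamp) (hlab : GoodLabeling G lab)
    (hn : ∀ v, lab v < n) {τ : ℕ} (hk : k₀ ≤ τ * (2 * n) + n) (hk' : k₀ ≤ 2 * n) (v : V)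
    (hv : stamp (root G lab v) ≤ τ * (2 * n) + n) : stamp v ≤ τ * (2 * n) + n + lab v := by
  induction v using hlab.induction with
  | h0 v hl =>
    rw [root_of_eq_zero hl] at hv
    omega
  | h1 v hl ih =>
    obtain ⟨hadj, hp⟩ := hlab.parent_spec hl
    have hvn := hn v
    have hle := ih (by rwa [hlab.root_parent hl])
    rcases lt_or_ge (stamp (parent G lab v)) (τ * (2 * n)) with hlt | hge
    · have := h.contact (by omega) hadj.symm hk' hlt
      omega
    · exact h.down hadj.symm hp hvn hge hle (by omega)

/-- The first cluster is covered in round `τ`, contacts its neighbors at the beginning of round `τ +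
1`, and the root of the adjacent cluster is reached by the upward steps, strictly before the start
slot of round `τ + 2`. -/
theorem Wave.hop (h : Wave G n 0 lab stamp) (hlab : GoodLabeling G lab)
    (hn : ∀ v, lab v < n) {τ : ℕ} {r r' : {r : V // lab r = 0}}
    (hadj : (clusterGraph G lab).Adj r r') (hr : stamp r ≤ τ * (2 * n) + n) :
    stamp r' + 1 ≤ (τ + 2) * (2 * n) + n := by
  obtain ⟨u, v, huv, hu, hv⟩ : ∃ u v, G.Adj u v ∧ root G lab u = r ∧ root G lab v = r' := by
    rw [clusterGraph, SimpleGraph.fromRel_adj] at hadj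
    rcases hadj.2 with ⟨u, v, huv, hu, hv⟩ | ⟨u, v, huv, hu, hv⟩
    · exact ⟨u, v, huv, hu, hv⟩
    · exact ⟨v, u, huv.symm, hv, hu⟩
  have h1 := h.le_of_root_le hlab hn (Nat.zero_le _) (Nat.zero_le _) u (by rwa [hu])
  have hun := hn u
  have hvn := hn v
  have h2 : stamp u < (τ + 1) * (2 * n) := by
    rw [Nat.add_mul]
    omega
  have h3 := h.contact (by omega) huv (Nat.zero_le _) h2
  have h4 := h.root_le hlab hn (τ := τ + 2) (Nat.zero_le _) (Nat.zero_le _) v (by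
    rw [Nat.add_mul] at h3 ⊢
    omega)
  rwa [hv] at h4

theorem Wave.walk (h : Wave G n 0 lab stamp) (hlab : GoodLabeling G lab)
    (hn : ∀ v, lab v < n) {r r' : {r : V // lab r = 0}} (p : (clusterGraph G lab).Walk r r')
    {τ : ℕ} (hr : stamp r ≤ τ * (2 * n) + n) :
    r = r' ∨ stamp r' + 1 ≤ (τ + 2 * p.length) * (2 * n) + n := by
  induction p generalizing τ with
  | nil => exact Or.inl rfl
  | cons hadj p ih =>
    rename_i a b c
    right
    have h1 := h.hop hlab hn hadj hr
    have e : (SimpleGraph.Walk.cons hadj p).length = p.length + 1 := rfl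
    rw [e]
    rcases ih (τ := τ + 2) (by omega) with rfl | h2
    · refine h1.trans ?_
      gcongr
      omega
    · refine h2.trans (le_of_eq ?_)
      ring

/-- A root that starts a new cluster has a small delay compared to the other roots. -/
theorem Wave.lt_of_start (h : Wave G n 0 lab stamp) (hG : G.Connected) (hlab : GoodLabeling G lab)
    (hn : ∀ v, lab v < n) {r r' : {r : V // lab r = 0}} (hne : r' ≠ r) {t t' : ℕ}
    (hr : stamp r = t * (2 * n) + n) (hr' : stamp r' ≤ t' * (2 * n) + n) :
    t < t' + 2 * (clusterGraph G lab).dist r' r := by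
  obtain ⟨p, hp⟩ := (hlab.clusterGraph_connected hG).exists_walk_length_eq_dist r' r
  rcases h.walk hlab hn p hr' with h1 | h1
  · exact absurd h1 hne
  -- The wave from `r'` reaches `r` strictly before a start slot; the `+ 1` in `h1` makes the
  -- inequality between delays strict.
  · rw [hp, hr] at h1
    exact lt_of_mul_lt_mul_right (a := 2 * n) (by omega) (Nat.zero_le _)

end wave

end Radio

namespace Radio

open Finset

/-! ### Random delays -/

/-- By connectedness the set together with `r` can be enlarged across a boundary edge, which
increases the distance to `r` by at most one. -/
theorem exists_card_eq_dist_le {Z : Type*} [Fintype Z] {H : SimpleGraph Z} (hH : H.Connected)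
    (r : Z) (K : ℕ) (hK : K + 1 ≤ Fintype.card Z) :
    ∃ U : Finset Z, U.card = K ∧ ∀ u ∈ U, u ≠ r ∧ H.dist u r ≤ K := by
  classical
  induction K with
  | zero => exact ⟨∅, rfl, by simp⟩
  | succ K ih =>
    obtain ⟨U, hU, hUr⟩ := ih (by omega)
    have hrU : r ∉ U := fun h => (hUr r h).1 rfl
    obtain ⟨w, -, hw⟩ : ∃ w ∈ (univ : Finset Z), w ∉ insert r U := by
      refine exists_mem_notMem_of_card_lt_card ?_
      rw [card_insert_of_notMem hrU, hU, card_univ]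
      omega
    obtain ⟨p⟩ := hH.preconnected r w
    obtain ⟨e, -, he1, he2⟩ := p.exists_boundary_dart (insert r U : Finset Z) (by simp)
      (by simpa using hw)
    have he1' : e.fst ∈ insert r U := he1
    have he2' : e.snd ∉ insert r U := he2
    have hd : H.dist e.fst r ≤ K := by
      rcases mem_insert.1 he1' with h | h
      · rw [h, SimpleGraph.dist_self]
        omega
      · exact (hUr _ h).2
    rw [mem_insert, not_or] at he2'
    refine ⟨insert e.snd U, by rw [card_insert_of_notMem he2'.2, hU], fun u hu => ?_⟩
    rcases mem_insert.1 hu with rfl | hu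
    · refine ⟨he2'.1, ?_⟩
      have h1 := hH.dist_triangle (u := e.snd) (v := e.fst) (w := r)
      have h2 : H.dist e.snd e.fst = 1 := SimpleGraph.dist_eq_one_iff_adj.2 e.adj.symm
      omega
    · exact ⟨(hUr u hu).1, (hUr u hu).2.trans (Nat.le_succ K)⟩

theorem dist_lt_card {Z : Type*} [Fintype Z] {H : SimpleGraph Z} (hH : H.Connected)
    (r r' : Z) : H.dist r r' < Fintype.card Z := by
  obtain ⟨p, hp, hl⟩ := hH.exists_path_of_dist r r'
  rw [← hl]
  exact hp.length_lt

theorem avg_fin_window (d l m : ℕ) [NeZero d] :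
    avg (fun t : Fin d => if l ≤ t.val ∧ t.val < l + m then (1 : ℝ) else 0) ≤ m / d := by
  rw [avg_eq, Fintype.card_fin]
  gcongr
  rw [Fin.sum_univ_eq_sum_range (fun t => if l ≤ t ∧ t < l + m then (1 : ℝ) else 0), ← sum_filter,
    sum_const, nsmul_one]
  have : (range d).filter (fun t => l ≤ t ∧ t < l + m) ⊆ Ico l (l + m) := by
    intro t ht
    exact mem_Ico.2 (mem_filter.1 ht).2
  have := card_le_card this
  rw [Nat.card_Ico, Nat.add_sub_cancel_left] at this
  exact_mod_cast this

theorem avg_fin_le (d a : ℕ) [NeZero d] (ha : a ≤ d) :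
    avg (fun t : Fin d => if a ≤ t.val then (1 : ℝ) else 0) = 1 - a / d := by
  rw [avg_eq, Fintype.card_fin, Fin.sum_univ_eq_sum_range (fun t => if a ≤ t then (1 : ℝ) else 0),
    ← sum_filter, sum_const, nsmul_one]
  have : (range d).filter (fun t => a ≤ t) = Ico a d := by
    ext t
    simp [and_comm]
  have hd : (d : ℝ) ≠ 0 := by exact_mod_cast NeZero.ne d
  rw [this, Nat.card_Ico, Nat.cast_sub ha, sub_div, div_self hd]

/-! ### The expected number of surviving roots -/

section delays

variable {V : Type*} [Fintype V] {Z : V → Prop}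

open Classical in
/-- The vertices whose delay is small compared to all others. -/
noncomputable def starters (H : SimpleGraph {v // Z v}) (del : V → ℕ) : Finset {v // Z v} :=
  univ.filter fun r => ∀ r', r' ≠ r → del r < del r' + 2 * H.dist r' r

theorem mem_starters {H : SimpleGraph {v // Z v}} {del : V → ℕ} {r : {v // Z v}} :
    r ∈ starters H del ↔ ∀ r', r' ≠ r → del r < del r' + 2 * H.dist r' r := by
  simp [starters]

/-- Splitting according to the delay `t` of `u` turns the event into products over `u` and `v`, to
which independence applies. -/
theorem avg_pair_le {d W : ℕ} [NeZero d] {u v : V} (huv : u ≠ v) (m : ℕ) :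
    avg (fun x : V → Sample d W =>
      if (x u).1.val ≤ (x v).1.val ∧ (x v).1.val < (x u).1.val + m then (1 : ℝ) else 0) ≤ m / d := by
  classical
  let g : Fin d → V → Sample d W → ℝ := fun t w y =>
    if w = u then (if y.1 = t then 1 else 0)
    else if t.val ≤ y.1.val ∧ y.1.val < t.val + m then 1 else 0
  have h1 : ∀ x : V → Sample d W,
      (if (x u).1.val ≤ (x v).1.val ∧ (x v).1.val < (x u).1.val + m then (1 : ℝ) else 0) =
      ∑ t : Fin d, ∏ w ∈ ({u, v} : Finset V), g t w (x w) := by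
    intro x
    simp only [prod_pair huv, g, if_true, if_neg huv.symm, ite_mul, one_mul, zero_mul]
    rw [sum_ite_eq, if_pos (mem_univ _)]
  simp only [h1]
  rw [avg_sum]
  have h2 : ∀ t : Fin d, avg (fun x : V → Sample d W => ∏ w ∈ ({u, v} : Finset V), g t w (x w)) ≤
      1 / d * (m / d) := by
    intro t
    rw [avg_pi_prod_subset, prod_pair huv]
    have h3 : avg (g t u) = 1 / d := by
      simp only [g, if_true]
      rw [avg_prod_fst (fun y : Fin d => if y = t then (1 : ℝ) else 0), avg_eq]
      simp
    have h4 : avg (g t v) ≤ m / d := by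
      simp only [g, if_neg huv.symm]
      rw [avg_prod_fst (fun y : Fin d => if t.val ≤ y.val ∧ y.val < t.val + m then (1 : ℝ) else 0)]
      exact avg_fin_window d t m
    rw [h3]
    gcongr
  refine (sum_le_sum fun t _ => h2 t).trans (le_of_eq ?_)
  have hd : (d : ℝ) ≠ 0 := by exact_mod_cast NeZero.ne d
  rw [sum_const, card_univ, Fintype.card_fin, nsmul_eq_mul]
  field_simp

/-- The expected number of starters, for few vertices. -/
theorem avg_starters_le_of_small {d W : ℕ} [NeZero d] {H : SimpleGraph {v // Z v}}
    (hH : H.Connected) (K : ℕ) (hK : Nat.card {v // Z v} ≤ K + 1) :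
    avg (fun x : V → Sample d W => ((starters H fun v => (x v).1.val).card : ℝ) - 1) ≤
      (K + 1) * (2 * K / d) * ((Nat.card {v // Z v} : ℝ) - 1) := by
  classical
  rw [Nat.card_eq_fintype_card] at hK ⊢
  let ind : {v // Z v} → {v // Z v} → (V → Sample d W) → ℝ := fun u v x =>
    if (x u).1.val ≤ (x v).1.val ∧ (x v).1.val < (x u).1.val + 2 * K then 1 else 0
  have hind : ∀ u v x, 0 ≤ ind u v x := fun u v x => by
    simp only [ind]
    split_ifs <;> norm_num
  have hle : ∀ x : V → Sample d W, ((starters H fun v => (x v).1.val).card : ℝ) - 1 ≤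
      ∑ v, ∑ u ∈ univ.erase v, ind u v x := by
    intro x
    have := hH.nonempty
    -- Distances are at most `K`, so every other starter has a delay within `2 * K` above the
    -- minimum, attained at `r₀`. Omitting `r₀` accounts for the `- 1`.
    obtain ⟨r₀, -, hr₀⟩ := exists_min_image (univ : Finset {v // Z v}) (fun v => (x v).1.val)
      univ_nonempty
    set S := starters H fun v => (x v).1.val with hS
    have h1 : (S.card : ℝ) - 1 ≤ (S.erase r₀).card := by
      have := pred_card_le_card_erase (s := S) (a := r₀)
      have h2 : S.card ≤ (S.erase r₀).card + 1 := by omega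
      have h3 : (S.card : ℝ) ≤ (S.erase r₀).card + 1 := by exact_mod_cast h2
      linarith
    refine h1.trans ?_
    calc ((S.erase r₀).card : ℝ) = ∑ v ∈ S.erase r₀, (1 : ℝ) := by simp
      _ ≤ ∑ v ∈ S.erase r₀, ∑ u ∈ univ.erase v, ind u v x := by
        refine sum_le_sum fun v hv => ?_
        obtain ⟨hv1, hv2⟩ := mem_erase.1 hv
        have h4 := mem_starters.1 hv2 r₀ (Ne.symm hv1)
        have h5 := dist_lt_card hH r₀ v
        have h6 : ind r₀ v x = 1 := if_pos ⟨hr₀ v (mem_univ v), by omega⟩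
        calc (1 : ℝ) = ind r₀ v x := h6.symm
          _ ≤ _ := single_le_sum (f := fun u => ind u v x) (fun u _ => hind u v x)
              (mem_erase.2 ⟨Ne.symm hv1, mem_univ _⟩)
      _ ≤ _ := sum_le_sum_of_subset_of_nonneg (subset_univ _)
          fun v _ _ => sum_nonneg fun u _ => hind u v x
  refine (avg_mono hle).trans ?_
  rw [avg_sum]
  have h7 : ∀ v : {v // Z v}, avg (fun x : V → Sample d W => ∑ u ∈ univ.erase v, ind u v x) ≤
      ((Fintype.card {v // Z v} : ℝ) - 1) * (2 * K / d) := by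
    intro v
    rw [avg_sum]
    calc ∑ u ∈ univ.erase v, avg (ind u v) ≤ ∑ u ∈ univ.erase v, (2 * K / d : ℝ) := by
          refine sum_le_sum fun u hu => ?_
          have := avg_pair_le (d := d) (W := W) (u := u.1) (v := v.1)
            (fun h => (mem_erase.1 hu).1 (Subtype.ext h)) (2 * K)
          push_cast at this
          exact this
      _ = _ := by
          rw [sum_const, card_erase_of_mem (mem_univ v), card_univ, nsmul_eq_mul,
            Nat.cast_sub (Fintype.card_pos_iff.2 ⟨v⟩)]
          simp
  refine (sum_le_sum fun v _ => h7 v).trans ?_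
  have := hH.nonempty
  have hc : (1 : ℝ) ≤ Fintype.card {v // Z v} := by
    exact_mod_cast Fintype.card_pos_iff.2 this
  have hK' : (Fintype.card {v // Z v} : ℝ) ≤ K + 1 := by exact_mod_cast hK
  rw [sum_const, card_univ, nsmul_eq_mul]
  calc (Fintype.card {v // Z v} : ℝ) * (((Fintype.card {v // Z v} : ℝ) - 1) * (2 * K / d))
      ≤ (K + 1) * (((Fintype.card {v // Z v} : ℝ) - 1) * (2 * K / d)) := by
        gcongr
    _ = _ := by ring

/-- The expected number of starters, for many vertices. -/
theorem avg_starters_le_of_large {d W : ℕ} [NeZero d] {H : SimpleGraph {v // Z v}}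
    (hH : H.Connected) (K a : ℕ) (hK : K + 1 ≤ Nat.card {v // Z v}) (ha : a ≤ d) :
    avg (fun x : V → Sample d W => ((starters H fun v => (x v).1.val).card : ℝ)) ≤
      Nat.card {v // Z v} * ((a + 2 * K) / d + (1 - a / d) ^ K) := by
  classical
  rw [Nat.card_eq_fintype_card] at hK ⊢
  have key : ∀ r : {v // Z v}, avg (fun x : V → Sample d W =>
      if r ∈ starters H (fun v => (x v).1.val) then (1 : ℝ) else 0) ≤
      (a + 2 * K) / d + (1 - a / d) ^ K := by
    intro r
    obtain ⟨U, hU, hUr⟩ := exists_card_eq_dist_le hH r K hK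
    have h1 : ∀ x : V → Sample d W,
        (if r ∈ starters H (fun v => (x v).1.val) then (1 : ℝ) else 0) ≤
        (if 0 ≤ (x r).1.val ∧ (x r).1.val < 0 + (a + 2 * K) then 1 else 0) +
        ∏ u ∈ U.map (Function.Embedding.subtype _), if a ≤ (x u).1.val then 1 else 0 := by
      intro x
      have hp : (0 : ℝ) ≤ ∏ u ∈ U.map (Function.Embedding.subtype _),
          if a ≤ (x u).1.val then 1 else 0 := prod_nonneg fun u _ => by split_ifs <;> norm_num
      by_cases hr : r ∈ starters H (fun v => (x v).1.val)
      -- A starter `r` has a delay below `a + 2 * K`, or else all `K` roots of `U`, at distance at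
      -- most `K`, have delays at least `a`.
      · rw [if_pos hr]
        by_cases hlt : (x r).1.val < a + 2 * K
        · rw [if_pos ⟨Nat.zero_le _, by omega⟩]
          linarith
        · rw [if_neg (by omega), zero_add]
          refine le_of_eq (Eq.symm (prod_eq_one fun u hu => if_pos ?_))
          obtain ⟨u', hu', rfl⟩ := mem_map.1 hu
          have h2 := mem_starters.1 hr u' (hUr u' hu').1
          have h3 := (hUr u' hu').2
          change a ≤ (x u'.1).1.val
          omega
      · rw [if_neg hr]
        have : (0 : ℝ) ≤ if 0 ≤ (x r).1.val ∧ (x r).1.val < 0 + (a + 2 * K) then 1 else 0 := by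
          split_ifs <;> norm_num
        linarith
    refine (avg_mono h1).trans ?_
    rw [avg_add]
    refine add_le_add ?_ (le_of_eq ?_)
    · rw [avg_pi_eval r.1 (fun y : Sample d W =>
        if 0 ≤ y.1.val ∧ y.1.val < 0 + (a + 2 * K) then (1 : ℝ) else 0),
        avg_prod_fst (fun y : Fin d => if 0 ≤ y.val ∧ y.val < 0 + (a + 2 * K) then (1 : ℝ) else 0)]
      have := avg_fin_window d 0 (a + 2 * K)
      push_cast at this
      exact this
    · rw [avg_pi_prod_subset _ (fun (_ : V) (y : Sample d W) => if a ≤ y.1.val then (1 : ℝ) else 0)]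
      rw [prod_const, card_map, hU,
        avg_prod_fst (fun y : Fin d => if a ≤ y.val then (1 : ℝ) else 0), avg_fin_le d a ha]
  have h4 : ∀ x : V → Sample d W, ((starters H fun v => (x v).1.val).card : ℝ) =
      ∑ r, if r ∈ starters H (fun v => (x v).1.val) then (1 : ℝ) else 0 := by
    intro x
    simp
  simp only [h4]
  rw [avg_sum]
  refine (sum_le_sum fun r _ => key r).trans (le_of_eq ?_)
  rw [sum_const, card_univ, nsmul_eq_mul]

/-- The expected number of starters other than one decreases by a factor of order `q`. -/
theorem avg_starters_le {q W : ℕ} [NeZero (q ^ 6)] (hq : 2 ≤ q) {H : SimpleGraph {v // Z v}}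
    (hH : H.Connected) :
    avg (fun x : V → Sample (q ^ 6) W => ((starters H fun v => (x v).1.val).card : ℝ) - 1) ≤
      6 / q * ((Nat.card {v // Z v} : ℝ) - 1) := by
  have := hH.nonempty
  have hc : 1 ≤ Nat.card {v // Z v} := Nat.card_pos
  have hc' : (1 : ℝ) ≤ Nat.card {v // Z v} := by exact_mod_cast hc
  have hq' : (2 : ℝ) ≤ q := by exact_mod_cast hq
  have hq0 : (0 : ℝ) < q := by linarith
  -- With few clusters the union bound over pairs costs about q² · q² / q⁶. With many clusters `a =
  -- q ^ 5` makes each of the two events of probability O(1/q), because (1 - 1/q)^(q²) ≤ e^(-q);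
  -- passing from the number of clusters to that number minus 1 costs a factor 2.
  rcases le_or_gt (Nat.card {v // Z v}) (q ^ 2 + 1) with h | h
  · refine (avg_starters_le_of_small hH (q ^ 2) h).trans ?_
    have hw : 0 ≤ (Nat.card {v // Z v} : ℝ) - 1 := by linarith
    gcongr
    push_cast
    have e : ((q : ℝ) ^ 2 + 1) * (2 * q ^ 2 / q ^ 6) = 2 * (q ^ 2 + 1) / q ^ 4 := by
      field_simp
    rw [e, div_le_div_iff₀ (by positivity) hq0]
    have : (q : ℝ) ^ 4 = q * q ^ 3 := by ring
    have h3 : 4 * (q : ℝ) ≤ q ^ 3 := by nlinarith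
    nlinarith
  · have h1 := avg_starters_le_of_large (W := W) (d := q ^ 6) hH (q ^ 2) (q ^ 5) (by omega)
      (Nat.pow_le_pow_right (by omega) (by norm_num))
    have h2 := avg_add (fun x : V → Sample (q ^ 6) W =>
      ((starters H fun v => (x v).1.val).card : ℝ) - 1) (fun _ => 1)
    simp only [sub_add_cancel, avg_const] at h2
    push_cast at h1
    have e1 : ((q : ℝ) ^ 5 + 2 * q ^ 2) / q ^ 6 ≤ 2 / q := by
      rw [div_le_div_iff₀ (by positivity) hq0]
      have : (2 : ℝ) ≤ q ^ 3 := by nlinarith [sq_nonneg ((q : ℝ) - 2)]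
      nlinarith [pow_pos hq0 3]
    have e2 : (1 - (q : ℝ) ^ 5 / q ^ 6) ^ q ^ 2 ≤ 1 / q := by
      have e3 : (q : ℝ) ^ 5 / q ^ 6 = 1 / q := by field_simp
      rw [e3]
      have h3 : 0 ≤ 1 - 1 / (q : ℝ) := by
        rw [sub_nonneg, div_le_one hq0]
        linarith
      calc (1 - 1 / (q : ℝ)) ^ q ^ 2 ≤ Real.exp (-(1 / q)) ^ q ^ 2 := by
            gcongr
            linarith [Real.add_one_le_exp (-(1 / (q : ℝ)))]
        _ = Real.exp (-q) := by
            rw [← Real.exp_nat_mul]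
            congr 1
            push_cast
            field_simp
        _ ≤ 1 / q := by
            rw [Real.exp_neg, ← one_div]
            gcongr
            linarith [Real.add_one_le_exp (q : ℝ)]
    have h4 : (Nat.card {v // Z v} : ℝ) ≤ 2 * ((Nat.card {v // Z v} : ℝ) - 1) := by
      have : 2 ≤ Nat.card {v // Z v} := by nlinarith
      have : (2 : ℝ) ≤ Nat.card {v // Z v} := by exact_mod_cast this
      linarith
    calc _ ≤ avg (fun x : V → Sample (q ^ 6) W =>
          ((starters H fun v => (x v).1.val).card : ℝ)) := by linarith
      _ ≤ Nat.card {v // Z v} * (((q : ℝ) ^ 5 + 2 * q ^ 2) / q ^ 6 +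
          (1 - (q : ℝ) ^ 5 / q ^ 6) ^ q ^ 2) := h1
      _ ≤ (2 * ((Nat.card {v // Z v} : ℝ) - 1)) * (2 / q + 1 / q) := by
          have h5 : 0 ≤ (1 - (q : ℝ) ^ 5 / q ^ 6) := by
            rw [sub_nonneg, div_le_one (by positivity)]
            exact pow_le_pow_right₀ (by linarith) (by norm_num)
          gcongr
      _ = _ := by ring

end delays

end Radio

namespace Radio

open Finset

/-! ### The clustering algorithm -/

/-- The state of a device between exchanges. -/
structure Main : Type where
  /-- the message of the source -/
  inp : Option Msg
  /-- the label -/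
  lab : ℕ
  /-- the round in which a root starts a new cluster -/
  del : ℕ
  /-- the time at which the device was reached, and what it received -/
  got : Option (ℕ × Msg)

/-- What the device received. -/
def Main.content (m : Main) : Msg :=
  match m.got with
  | some (_, μ) => μ
  | none => []

/-- The exchange at time `k`; received messages are transformed by `rel`. -/
def relay (n : ℕ) (rel : Msg → Msg) (k : ℕ) : Exchange Main where
  tx m := match m.got with
    | some (s, μ) => if SendOK n k m.lab s then some μ else none
    | none => none
  rx m := match m.got with
    | some _ => false
    | none => decide (RecvOK n k m.lab)
  fin m q := match m.got with
    | some _ => m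
    | none => match q with
      | some (Sum.inr μ) => { m with got := some (k, rel μ) }
      -- A failed walk also counts as reached, so that no device pays for the phases of two
      -- receptions; this keeps the energy bound valid in failing executions.
      | some (Sum.inl _) => { m with got := some (k, []) }
      | none => if StartOK n k m.lab m.del then { m with got := some (k, []) } else m

/-- The exchanges at times `k₀, …, k₀ + N - 1`. -/
def relays (n : ℕ) (rel : Msg → Msg) (d W T k₀ N : ℕ) :
    List (Step (Main × Scratch) (Sample d W)) :=
  (List.range' k₀ N).flatMap fun k => (relay n rel k).prog d W T

/-- A local step without communication. -/
def localStep (d W : ℕ) (g : Main → ℕ → Main) : Step (Main × Scratch) (Sample d W) where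
  plan _ _ _ := Act.idle
  upd st x _ := (g st.1 x.1.val, none)

/-- What was received becomes the label, in unary; a random delay is chosen. -/
def resetCluster (m : Main) (t : ℕ) : Main :=
  { inp := m.inp, lab := m.content.length, del := t, got := none }

/-- What was received becomes the label, in unary; the source is ready to send its message. -/
def resetCast (m : Main) (_ : ℕ) : Main :=
  -- The broadcast uses only times below `2 * n`, i.e. round 0, so delay 1 prevents roots from
  -- starting; the source counts as reached at time 0.
  { inp := m.inp, lab := m.content.length, del := 1, got := m.inp.map fun μ => (0, μ) }

/-- One round of merging clusters. -/
def mergeProg (n d W T : ℕ) : List (Step (Main × Scratch) (Sample d W)) :=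
  localStep d W resetCluster :: relays n (List.cons true) d W T 0 (d * (2 * n))

/-- The final broadcast in a single cluster. -/
def castProg (n d W T : ℕ) : List (Step (Main × Scratch) (Sample d W)) :=
  localStep d W resetCast :: relays n id d W T 1 (2 * n - 1)

/-- The whole algorithm. -/
def broadcastProg (n d W T I : ℕ) : List (Step (Main × Scratch) (Sample d W)) :=
  (List.replicate I (mergeProg n d W T)).flatten ++ castProg n d W T

/-- The initial state. -/
def initState (i : Option Msg) : Main × Scratch := (⟨i, 0, 0, none⟩, none)

/-! ### Correctness and failure probability of the algorithm -/

section correctness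

variable {V : Type*} [Fintype V] {G : SimpleGraph V} {n d W T : ℕ} {rel : Msg → Msg}

/-- A successful exchange. -/
def ValidStep (G : SimpleGraph V) (W : ℕ) (E : Exchange Main) (M M' : V → Main) : Prop :=
  ∃ q : V → Scratch, (∀ v, E.Possible G M W v (q v)) ∧ (∀ v p, q v ≠ some (Sum.inl p)) ∧
    ∀ v, M' v = E.fin (M v) (q v)

theorem relay_tx_eq_some {k : ℕ} {m : Main} {μ : Msg} : (relay n rel k).tx m = some μ ↔
    ∃ s, m.got = some (s, μ) ∧ SendOK n k m.lab s := by
  simp only [relay]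
  rcases m.got with _ | ⟨s, μ'⟩
  · simp
  · simp only [Option.some.injEq, Prod.mk.injEq]
    split_ifs with h
    · simp only [Option.some.injEq]
      exact ⟨fun h' => ⟨s, ⟨rfl, h'⟩, h⟩, fun ⟨s', h', _⟩ => h'.2⟩
    · simp only [false_iff, not_exists, not_and]
      rintro s' ⟨rfl, -⟩
      exact h

theorem relay_fin_fields (k : ℕ) (m : Main) (q : Scratch) :
    ((relay n rel k).fin m q).inp = m.inp ∧ ((relay n rel k).fin m q).lab = m.lab ∧
      ((relay n rel k).fin m q).del = m.del := by
  simp only [relay]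
  rcases m.got with _ | g
  · rcases q with _ | p | μ
    · simp only
      split_ifs <;> exact ⟨rfl, rfl, rfl⟩
    · exact ⟨rfl, rfl, rfl⟩
    · exact ⟨rfl, rfl, rfl⟩
  · exact ⟨rfl, rfl, rfl⟩

theorem relay_fin_of_got (k : ℕ) {m : Main} (q : Scratch) {g : ℕ × Msg} (h : m.got = some g) :
    (relay n rel k).fin m q = m := by
  simp only [relay, h]

theorem ValidStep.new {k : ℕ} {M M' : V → Main} (h : ValidStep G W (relay n rel k) M M') {v : V}
    {s : ℕ} {μ : Msg} (h0 : (M v).got = none) (h1 : (M' v).got = some (s, μ)) :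
    s = k ∧ ((μ = [] ∧ StartOK n k (M v).lab (M v).del) ∨
      ∃ u s' μ', G.Adj v u ∧ (M u).got = some (s', μ') ∧ μ = rel μ') := by
  obtain ⟨q, hq1, hq2, hq3⟩ := h
  rw [hq3] at h1
  simp only [relay, h0] at h1
  have hp := hq1 v
  rcases hq : q v with _ | p | μ'
  · simp only [hq] at h1
    split_ifs at h1 with hs
    · simp only [Option.some.injEq, Prod.mk.injEq] at h1
      exact ⟨h1.1.symm, Or.inl ⟨h1.2.symm, hs⟩⟩
    · rw [h0] at h1
      cases h1
  · exact absurd hq (hq2 v p)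
  · rw [hq] at h1 hp
    simp only [Option.some.injEq, Prod.mk.injEq] at h1
    obtain ⟨-, u, hadj, hu⟩ := hp
    obtain ⟨s', hs', -⟩ := relay_tx_eq_some.1 hu
    exact ⟨h1.1.symm, Or.inr ⟨u, s', μ', hadj, hs', h1.2.symm⟩⟩

theorem ValidStep.recv {k : ℕ} {M M' : V → Main} (h : ValidStep G W (relay n rel k) M M') {u v : V}
    {s : ℕ} {μ : Msg} (h0 : (M v).got = none) (hr : RecvOK n k (M v).lab) (hadj : G.Adj u v)
    (hu : (M u).got = some (s, μ)) (hs : SendOK n k (M u).lab s) : (M' v).got ≠ none := by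
  obtain ⟨q, hq1, hq2, hq3⟩ := h
  have hE : (relay n rel k).Engaged G M v := by
    refine ⟨by simp [relay, h0], by simp [relay, h0, hr], u, hadj.symm, ?_⟩
    rw [relay_tx_eq_some.2 ⟨s, hu, hs⟩]
    exact Option.some_ne_none μ
  have hp := hq1 v
  rw [hq3]
  rcases hq : q v with _ | p | μ'
  · rw [hq] at hp
    exact absurd hE hp
  · exact absurd hq (hq2 v p)
  · simp [relay, h0]

theorem ValidStep.start {k : ℕ} {M M' : V → Main} (h : ValidStep G W (relay n rel k) M M') {v : V}
    (h0 : (M v).got = none) (hs : StartOK n k (M v).lab (M v).del) : (M' v).got ≠ none := by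
  obtain ⟨q, hq1, hq2, hq3⟩ := h
  rw [hq3]
  rcases hq : q v with _ | p | μ'
  · simp [relay, h0, hs]
  · exact absurd hq (hq2 v p)
  · simp [relay, h0]

/-- The states after the exchanges at times `k₀, …, k - 1`, if all of them were successful. -/
structure Inv (G : SimpleGraph V) (n : ℕ) (rel : Msg → Msg) (k₀ k : ℕ) (M₀ M : V → Main) : Prop where
  inp : ∀ v, (M v).inp = (M₀ v).inp
  lab : ∀ v, (M v).lab = (M₀ v).lab
  del : ∀ v, (M v).del = (M₀ v).del
  lt : ∀ v s μ, (M v).got = some (s, μ) → s < k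
  wave : ∀ u v j, k₀ ≤ j → j < k → G.Adj u v → ∀ s μ, (M u).got = some (s, μ) → s < j →
    SendOK n j (M₀ u).lab s → RecvOK n j (M₀ v).lab → ∃ s' μ', (M v).got = some (s', μ') ∧ s' ≤ j
  start : ∀ v j, k₀ ≤ j → j < k → StartOK n j (M₀ v).lab (M₀ v).del →
    ∃ s' μ', (M v).got = some (s', μ') ∧ s' ≤ j
  old : ∀ v g, (M₀ v).got = some g → (M v).got = some g
  -- Contents are traced to strictly earlier times, which permits induction on the time of arrival.
  src : ∀ v s μ, (M v).got = some (s, μ) → (M₀ v).got = some (s, μ) ∨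
    (μ = [] ∧ StartOK n s (M₀ v).lab (M₀ v).del) ∨
    ∃ u s' μ', G.Adj v u ∧ (M u).got = some (s', μ') ∧ s' < s ∧ μ = rel μ'

theorem Inv.init {k₀ : ℕ} {M₀ : V → Main}
    (h : ∀ v s μ, (M₀ v).got = some (s, μ) → s < k₀) : Inv G n rel k₀ k₀ M₀ M₀ where
  inp _ := rfl
  lab _ := rfl
  del _ := rfl
  lt := h
  wave _ _ _ h1 h2 := by omega
  start _ _ h1 h2 := by omega
  old _ _ h := h
  src _ _ _ h := Or.inl h

theorem Inv.step {k₀ k : ℕ} {M₀ M M' : V → Main} (h : Inv G n rel k₀ k M₀ M)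
    (hM' : ValidStep G W (relay n rel k) M M') : Inv G n rel k₀ (k + 1) M₀ M' := by
  have hfields : ∀ v, (M' v).inp = (M v).inp ∧ (M' v).lab = (M v).lab ∧
      (M' v).del = (M v).del := by
    obtain ⟨q, -, -, hq⟩ := hM'
    intro v
    rw [hq]
    exact relay_fin_fields k _ _
  have hkeep : ∀ v g, (M v).got = some g → (M' v).got = some g := by
    have hM'' := hM'
    obtain ⟨q, -, -, hq⟩ := hM''
    intro v g hg
    rw [hq, relay_fin_of_got k _ hg, hg]
  have hcases : ∀ v s μ, (M' v).got = some (s, μ) → (M v).got = some (s, μ) ∨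
      ((M v).got = none ∧ s = k) := by
    intro v s μ hv
    rcases hg : (M v).got with _ | g
    · exact Or.inr ⟨rfl, (hM'.new hg hv).1⟩
    · left
      rw [← hkeep v g hg, hv]
  have hnew : ∀ v, (M v).got = none → (M' v).got ≠ none →
      ∃ s' μ', (M' v).got = some (s', μ') ∧ s' ≤ k := by
    intro v h0 h1
    obtain ⟨⟨s', μ'⟩, hs⟩ := Option.ne_none_iff_exists'.1 h1
    exact ⟨s', μ', hs, (hM'.new h0 hs).1.le⟩
  have hold : ∀ v, (M v).got ≠ none → ∃ s' μ', (M' v).got = some (s', μ') ∧ s' ≤ k := by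
    intro v h1
    obtain ⟨⟨s', μ'⟩, hs⟩ := Option.ne_none_iff_exists'.1 h1
    exact ⟨s', μ', hkeep v _ hs, (h.lt v s' μ' hs).le⟩
  refine ⟨fun v => (hfields v).1.trans (h.inp v), fun v => (hfields v).2.1.trans (h.lab v),
    fun v => (hfields v).2.2.trans (h.del v), ?_, ?_, ?_, fun v g hg => hkeep v g (h.old v g hg), ?_⟩
  · intro v s μ hv
    rcases hcases v s μ hv with h1 | ⟨-, rfl⟩
    · exact (h.lt v s μ h1).trans (Nat.lt_succ_self k)
    · exact Nat.lt_succ_self s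
  · intro u v j hj1 hj2 hadj s μ hu hsj hsend hrecv
    have hu' : (M u).got = some (s, μ) := by
      rcases hcases u s μ hu with h1 | ⟨-, rfl⟩
      · exact h1
      · omega
    rcases Nat.lt_succ_iff_lt_or_eq.1 hj2 with hlt | rfl
    · obtain ⟨s', μ', h1, h2⟩ := h.wave u v j hj1 hlt hadj s μ hu' hsj hsend hrecv
      exact ⟨s', μ', hkeep v _ h1, h2⟩
    · by_cases h0 : (M v).got = none
      · exact hnew v h0 (hM'.recv h0 (by rwa [h.lab]) hadj hu' (by rwa [h.lab]))
      · exact hold v h0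
  · intro v j hj1 hj2 hs
    rcases Nat.lt_succ_iff_lt_or_eq.1 hj2 with hlt | rfl
    · obtain ⟨s', μ', h1, h2⟩ := h.start v j hj1 hlt hs
      exact ⟨s', μ', hkeep v _ h1, h2⟩
    · by_cases h0 : (M v).got = none
      · exact hnew v h0 (hM'.start h0 (by rwa [h.lab, h.del]))
      · exact hold v h0
  · intro v s μ hv
    rcases hcases v s μ hv with h1 | ⟨h0, rfl⟩
    · rcases h.src v s μ h1 with h2 | h2 | ⟨u, s', μ', hadj, hu, hs, hμ⟩
      · exact Or.inl h2
      · exact Or.inr (Or.inl h2)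
      · exact Or.inr (Or.inr ⟨u, s', μ', hadj, hkeep u _ hu, hs, hμ⟩)
    · rcases (hM'.new h0 hv).2 with ⟨h2, h3⟩ | ⟨u, s', μ', hadj, hu, hμ⟩
      · exact Or.inr (Or.inl ⟨h2, by rwa [h.lab, h.del] at h3⟩)
      · exact Or.inr (Or.inr ⟨u, s', μ', hadj, hkeep u _ hu, h.lt u s' μ' hu, hμ⟩)

/-- The time at which a device was reached, at most `K`. -/
def stamp (K : ℕ) (m : Main) : ℕ :=
  match m.got with
  | some (s, _) => s
  | none => K

theorem Inv.stamp_le {k₀ K : ℕ} {M₀ M : V → Main} (h : Inv G n rel k₀ K M₀ M) (v : V) :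
    stamp K (M v) ≤ K := by
  rw [stamp]
  rcases hg : (M v).got with _ | ⟨s, μ⟩
  · exact le_rfl
  · exact (h.lt v s μ hg).le

theorem exists_got_of_stamp_lt {K : ℕ} {m : Main} (h : stamp K m < K) :
    ∃ μ, m.got = some (stamp K m, μ) := by
  rw [stamp] at h ⊢
  rcases hg : m.got with _ | ⟨s, μ⟩
  · rw [hg] at h
    exact absurd h (lt_irrefl K)
  · exact ⟨μ, rfl⟩

theorem stamp_of_got {K : ℕ} {m : Main} {s : ℕ} {μ : Msg} (h : m.got = some (s, μ)) :
    stamp K m = s := by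
  rw [stamp, h]

theorem Inv.toWave {k₀ K : ℕ} {M₀ M : V → Main} (h : Inv G n rel k₀ K M₀ M) :
    Wave G n k₀ (fun v => (M₀ v).lab) (fun v => stamp K (M v)) := by
  intro u v j hj hadj hu hsend hrecv
  rcases lt_or_ge j K with hlt | hge
  · obtain ⟨μ, hμ⟩ := exists_got_of_stamp_lt (hu.trans hlt)
    obtain ⟨s', μ', h1, h2⟩ := h.wave u v j hj hlt hadj _ μ hμ hu hsend hrecv
    change stamp K (M v) ≤ j
    rwa [stamp_of_got h1]
  -- Unreached devices have the default stamp `K`, so nothing is claimed from time `K` on.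
  · exact (h.stamp_le v).trans hge

/-- A sequence of exchanges, if each of them is successful with high probability. -/
theorem wp_relays_le [NeZero d] (hW : 0 < W)
    (hG : ∀ (v : V) (S : Finset V), (∀ u ∈ S, G.Adj v u) → S.card < 2 ^ W) {k₀ N : ℕ}
    {M₀ : V → Main} {f : (V → Main × Scratch) → ℝ} {B : ℝ} (hB : 0 ≤ B) (hf1 : ∀ c, f c ≤ 1)
    (hf : ∀ c, Inv G n rel k₀ (k₀ + N) M₀ (fun v => (c v).1) → f c ≤ B) {c : V → Main × Scratch}
    (h0 : ∀ v s μ, (M₀ v).got = some (s, μ) → s < k₀) (hc : (fun v => (c v).1) = M₀) :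
    wp W G (relays n rel d W T k₀ N) f c ≤
      B + N * ((985 / 1000) ^ T * (Fintype.card V : ℝ) ^ 2) := by
  set η : ℝ := (985 / 1000) ^ T * (Fintype.card V : ℝ) ^ 2
  -- Induction on the number of remaining exchanges: each failure adds at most `η`, as `f` is at
  -- most 1.
  have key : ∀ j i, i + j = N → ∀ c : V → Main × Scratch,
      Inv G n rel k₀ (k₀ + i) M₀ (fun v => (c v).1) →
      wp W G (relays n rel d W T (k₀ + i) j) f c ≤ B + j * η := by
    intro j
    induction j with
    | zero =>
      intro i hi c hc
      rw [add_zero] at hi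
      subst hi
      simpa [relays, wp] using hf c hc
    | succ j ih =>
      intro i hi c hc
      have e : relays n rel d W T (k₀ + i) (j + 1) =
          (relay n rel (k₀ + i)).prog d W T ++ relays n rel d W T (k₀ + (i + 1)) j := by
        simp only [relays, List.range'_succ, List.flatMap_cons, add_assoc]
      rw [e, wp_append]
      have hj0 : 0 ≤ B + j * η := by positivity
      refine ((relay n rel (k₀ + i)).wp_prog_le hW T c ?_ hj0 zero_le_one ?_ ?_).trans ?_
      · exact fun v => hG v _ fun u hu => ((relay n rel (k₀ + i)).mem_sources.1 hu).1
      · intro q hq1 hq2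
        refine ih (i + 1) (by omega) _ (hc.step (W := W) ⟨q, hq1, hq2, fun v => rfl⟩)
      · intro q _
        refine (wp_mono hf1 _).trans_eq (wp_const _ 1 _)
      · push_cast
        change B + j * η + 1 * η ≤ B + (j + 1) * η
        exact le_of_eq (by ring)
  have := key N 0 (zero_add N) c (by rw [hc]; exact Inv.init h0)
  simpa using this

/-- The new label: the length of what was received. -/
def newLab (c : V → Main × Scratch) (v : V) : ℕ := (c v).1.content.length

/-- The number of clusters. -/
noncomputable def clusters (c : V → Main × Scratch) : ℕ := Nat.card {v // newLab c v = 0}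

theorem content_of_got {m : Main} {s : ℕ} {μ : Msg} (h : m.got = some (s, μ)) : m.content = μ := by
  rw [Main.content, h]

theorem starters_nonempty {Z : V → Prop} {H : SimpleGraph {v // Z v}} (hH : H.Connected)
    (del : V → ℕ) : (starters H del).Nonempty := by
  classical
  have := hH.nonempty
  obtain ⟨r₀, -, hr₀⟩ := exists_min_image (univ : Finset {v // Z v}) (fun v => del v) univ_nonempty
  refine ⟨r₀, mem_starters.2 fun r' hne => ?_⟩
  have h1 := hr₀ r' (mem_univ r')
  have h2 := hH.pos_dist_of_ne hne
  omega

/-- The result of a successful round of merging. -/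
theorem Inv.merge {M₀ : V → Main} (hG : G.Connected) (hn : Fintype.card V = n)
    (hlab : GoodLabeling G fun v => (M₀ v).lab) (hdel : ∀ v, (M₀ v).del < d)
    (hgot : ∀ v, (M₀ v).got = none) {c : V → Main × Scratch}
    (h : Inv G n (List.cons true) 0 (d * (2 * n)) M₀ (fun v => (c v).1)) :
    GoodLabeling G (newLab c) ∧ clusters c ≤
      (starters (clusterGraph G fun v => (M₀ v).lab) fun v => (M₀ v).del).card := by
  set K := d * (2 * n) with hK
  have hlt : ∀ v, (M₀ v).lab < n := fun v => (hlab.lt_card v).trans_eq hn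
  have hw := h.toWave
  have hn0 : 0 < n := by
    obtain ⟨v⟩ := hG.nonempty
    exact (Nat.zero_le _).trans_lt (hlt v)
  have hround : ∀ t < d, t * (2 * n) + 2 * n ≤ K := by
    intro t ht
    calc t * (2 * n) + 2 * n = (t + 1) * (2 * n) := by ring
      _ ≤ _ := Nat.mul_le_mul_right _ ht
  have hroot : ∀ v, (M₀ v).lab = 0 → stamp K (c v).1 ≤ (M₀ v).del * (2 * n) + n := by
    intro v hv
    have h1 := hround _ (hdel v)
    have h2 := mul_add_mod_div (R := 2 * n) (τ := (M₀ v).del) (ρ := n) (by omega)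
    obtain ⟨s', μ', h3, h4⟩ := h.start v ((M₀ v).del * (2 * n) + n) (Nat.zero_le _) (by omega)
      ⟨h2.1, hv, h2.2.symm⟩
    rwa [stamp_of_got h3]
  -- A root is reached at the latest when its own delay expires, and the downward steps of the same
  -- round then cover its cluster.
  have hall : ∀ v, ∃ μ, (c v).1.got = some (stamp K (c v).1, μ) := by
    intro v
    refine exists_got_of_stamp_lt ?_
    have h1 := hround _ (hdel (root G (fun v => (M₀ v).lab) v))
    have h2 := hw.le_of_root_le hlab hlt (Nat.zero_le _) (Nat.zero_le _) v
      (hroot _ (hlab.lab_root v))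
    have := hlt v
    change stamp K (c v).1 ≤ _ at h2
    omega
  have hsrc : ∀ v, (newLab c v = 0 ∧ StartOK n (stamp K (c v).1) (M₀ v).lab (M₀ v).del) ∨
      ∃ u, G.Adj v u ∧ newLab c u + 1 = newLab c v := by
    intro v
    obtain ⟨μ, hμ⟩ := hall v
    rcases h.src v _ μ hμ with h1 | ⟨rfl, h2⟩ | ⟨u, s', μ', hadj, hu, -, rfl⟩
    · rw [hgot] at h1
      cases h1
    · left
      exact ⟨by rw [newLab, content_of_got hμ]; rfl, h2⟩
    · right
      refine ⟨u, hadj, ?_⟩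
      rw [newLab, newLab, content_of_got hμ, content_of_got hu]
      rfl
  refine ⟨fun v hv => ?_, ?_⟩
  · rcases hsrc v with h1 | h1
    · exact absurd h1.1 hv
    · exact h1
  · have hz : ∀ v, newLab c v = 0 →
        (M₀ v).lab = 0 ∧ stamp K (c v).1 = (M₀ v).del * (2 * n) + n := by
      intro v hv
      rcases hsrc v with ⟨-, h1, h2, h3⟩ | ⟨u, -, hu⟩
      · refine ⟨h2, ?_⟩
        have := Nat.div_add_mod (stamp K (c v).1) (2 * n)
        rw [h1, ← h3] at this
        rw [← this, mul_comm]
      · omega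
    have hmem : ∀ v (hv : newLab c v = 0), (⟨v, (hz v hv).1⟩ : {v // (M₀ v).lab = 0}) ∈
        starters (clusterGraph G fun v => (M₀ v).lab) fun v => (M₀ v).del := by
      intro v hv
      refine mem_starters.2 fun r' hne => ?_
      exact hw.lt_of_start hG hlab hlt hne (hz v hv).2 (hroot r' r'.2)
    rw [clusters, ← Fintype.card_coe, ← Nat.card_eq_fintype_card]
    refine Nat.card_le_card_of_injective (fun v => ⟨⟨v.1, (hz v.1 v.2).1⟩, hmem v.1 v.2⟩) ?_
    intro v w hvw
    exact Subtype.ext (congrArg (fun r => r.1.1) hvw)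

/-- The result of a successful broadcast in a single cluster. -/
theorem Inv.cast {M₀ : V → Main} (hn : Fintype.card V = n)
    (hlab : GoodLabeling G fun v => (M₀ v).lab) (hone : ∀ u v, (M₀ u).lab = 0 → (M₀ v).lab = 0 → u = v)
    (hdel : ∀ v, (M₀ v).del = 1) {s : V} {m : Msg} (hs : (M₀ s).got = some (0, m))
    (hne : ∀ v, v ≠ s → (M₀ v).got = none) {M : V → Main}
    (h : Inv G n id 1 (2 * n) M₀ M) (v : V) : (M v).content = m := by
  have hlt : ∀ v, (M₀ v).lab < n := fun v => (hlab.lt_card v).trans_eq hn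
  have hw := h.toWave
  have hstamp : stamp (2 * n) (M s) = 0 := stamp_of_got (h.old s _ hs)
  have hroot := hw.root_le hlab hlt (τ := 0) (by omega) (by have := hlt s; omega) s (by
    have := hlt s
    omega)
  have hv := hw.le_of_root_le hlab hlt (τ := 0) (by have := hlt s; omega)
    (by have := hlt s; omega) v (by
      rw [hone _ _ (hlab.lab_root v) (hlab.lab_root s)]
      exact Nat.le_of_succ_le hroot)
  have hlt' : stamp (2 * n) (M v) < 2 * n := by
    change stamp (2 * n) (M v) ≤ _ at hv
    have := hlt v
    omega
  have key : ∀ t v μ, (M v).got = some (t, μ) → μ = m := by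
    intro t
    induction t using Nat.strong_induction_on with
    | _ t ih =>
      intro v μ hv
      rcases h.src v t μ hv with h1 | ⟨-, -, -, h1⟩ | ⟨u, s', μ', -, hu, hs', hμ⟩
      · by_cases hvs : v = s
        · rw [hvs, hs] at h1
          exact (Prod.mk.inj (Option.some.inj h1)).2.symm
        · rw [hne v hvs] at h1
          cases h1
      · rw [hdel, Nat.div_eq_of_lt (h.lt v t μ hv)] at h1
        cases h1
      · exact hμ.trans (ih s' hs' u μ' hu)
  obtain ⟨μ, hμ⟩ := exists_got_of_stamp_lt hlt'
  rw [content_of_got hμ]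
  exact key _ _ _ hμ

/-- The devices know their inputs, and the new labels form a good labeling. -/
def Sound (G : SimpleGraph V) (s : V) (m : Msg) (c : V → Main × Scratch) : Prop :=
  (∀ v, (c v).1.inp = input s m v) ∧ GoodLabeling G (newLab c)

theorem Sound.one_le_clusters [Nonempty V] {s : V} {m : Msg} {c : V → Main × Scratch}
    (h : Sound G s m c) : (1 : ℝ) ≤ clusters c := by
  obtain ⟨v⟩ := ‹Nonempty V›
  obtain ⟨u, hu⟩ := h.2.exists_eq v 0 (Nat.zero_le _)
  have : Nonempty {v // newLab c v = 0} := ⟨⟨u, hu⟩⟩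
  have h1 : 1 ≤ clusters c := Nat.card_pos
  exact_mod_cast h1

/-- One round of merging, in expectation. -/
theorem wp_mergeProg_le {q : ℕ} (hq : 2 ≤ q) [NeZero (q ^ 6)] (hW : 0 < W)
    (hdeg : ∀ (v : V) (S : Finset V), (∀ u ∈ S, G.Adj v u) → S.card < 2 ^ W) (hG : G.Connected)
    (hn : Fintype.card V = n) {s : V} {m : Msg} {f : (V → Main × Scratch) → ℝ} {α β : ℝ}
    (hα : 0 ≤ α) (hβ : 0 ≤ β) (hf1 : ∀ c, f c ≤ 1)
    (hf : ∀ c, Sound G s m c → f c ≤ α * ((clusters c : ℝ) - 1) + β) {c : V → Main × Scratch}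
    (hc : Sound G s m c) :
    wp W G (mergeProg n (q ^ 6) W T) f c ≤ α * (6 / q * ((clusters c : ℝ) - 1)) +
      (β + (q ^ 6 * (2 * n) : ℕ) * ((985 / 1000) ^ T * (n : ℝ) ^ 2)) := by
  set η : ℝ := (985 / 1000) ^ T * (n : ℝ) ^ 2 with hη
  have hH := hc.2.clusterGraph_connected hG
  have h1 : ∀ x : V → Sample (q ^ 6) W, wp W G (relays n (List.cons true) (q ^ 6) W T 0
      (q ^ 6 * (2 * n))) f ((localStep (q ^ 6) W resetCluster).next W G c x) ≤
      α * (((starters (clusterGraph G (newLab c)) fun v => (x v).1.val).card : ℝ) - 1) +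
        (β + (q ^ 6 * (2 * n) : ℕ) * η) := by
    intro x
    have h2 : (1 : ℝ) ≤ (starters (clusterGraph G (newLab c)) fun v => (x v).1.val).card := by
      exact_mod_cast card_pos.2 (starters_nonempty hH _)
    have h3 := wp_relays_le (d := q ^ 6) (T := T) (n := n) (rel := List.cons true) (k₀ := 0)
      (N := q ^ 6 * (2 * n)) (f := f) hW hdeg
      (M₀ := fun v => resetCluster (c v).1 (x v).1.val)
      (B := α * (((starters (clusterGraph G (newLab c)) fun v => (x v).1.val).card : ℝ) - 1) + β)
      (by nlinarith) hf1 (by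
        intro c' hc'
        rw [zero_add] at hc'
        have h4 := hc'.merge hG hn (d := q ^ 6) hc.2 (fun v => (x v).1.isLt) (fun v => rfl)
        refine (hf c' ⟨fun v => (hc'.inp v).trans (hc.1 v), h4.1⟩).trans ?_
        have h5 : (clusters c' : ℝ) ≤
            (starters (clusterGraph G (newLab c)) fun v => (x v).1.val).card := by
          exact_mod_cast h4.2
        gcongr) (c := (localStep (q ^ 6) W resetCluster).next W G c x)
      (fun v s μ hv => by cases hv) rfl
    rw [hn, ← hη] at h3
    linarith
  refine (avg_mono h1).trans ?_
  rw [avg_add, avg_const_mul, avg_const]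
  gcongr
  exact avg_starters_le hq hH

/-- The final broadcast. -/
theorem wp_castProg_le [NeZero d] (hW : 0 < W)
    (hdeg : ∀ (v : V) (S : Finset V), (∀ u ∈ S, G.Adj v u) → S.card < 2 ^ W) (hG : G.Connected)
    (hn : Fintype.card V = n) {s : V} {m : Msg} {f : (V → Main × Scratch) → ℝ}
    (hf1 : ∀ c, f c ≤ 1) (hf : ∀ c, (∀ v, (c v).1.content = m) → f c ≤ 0)
    {c : V → Main × Scratch} (hc : Sound G s m c) :
    wp W G (castProg n d W T) f c ≤
      1 * ((clusters c : ℝ) - 1) + (2 * n : ℕ) * ((985 / 1000) ^ T * (n : ℝ) ^ 2) := by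
  set η : ℝ := (985 / 1000) ^ T * (n : ℝ) ^ 2 with hη
  have hη0 : 0 ≤ η := by positivity
  have := hG.nonempty
  have hn0 : 0 < n := hn ▸ Fintype.card_pos
  refine avg_le_const fun x => ?_
  rcases Nat.lt_or_ge (clusters c) 2 with hlt | hge
  · have h1 := hc.one_le_clusters
    have hone : ∀ u v, newLab c u = 0 → newLab c v = 0 → u = v := by
      intro u v hu hv
      have : Subsingleton {v // newLab c v = 0} :=
        Finite.card_le_one_iff_subsingleton.1 (Nat.lt_succ_iff.1 hlt)
      exact congrArg Subtype.val (Subsingleton.elim (⟨u, hu⟩ : {v // newLab c v = 0}) ⟨v, hv⟩)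
    have h3 := wp_relays_le (T := T) (n := n) (d := d) (rel := id) (k₀ := 1) (N := 2 * n - 1) (f := f) hW hdeg
      (M₀ := fun v => resetCast (c v).1 (x v).1.val) (B := 0) le_rfl hf1 (by
        intro c' hc'
        rw [Nat.add_sub_cancel' (by omega)] at hc'
        refine hf c' (hc'.cast (s := s) hn hc.2 hone (fun _ => rfl) ?_ ?_)
        · simp [resetCast, hc.1, input]
        · intro v hv
          simp [resetCast, hc.1, input, hv]) (c := (localStep d W resetCast).next W G c x)
      (fun v t μ hv => by
        simp only [resetCast, Option.map_eq_some_iff, Prod.mk.injEq] at hv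
        obtain ⟨_, -, h, -⟩ := hv
        omega) rfl
    rw [hn, ← hη] at h3
    refine h3.trans ?_
    have : ((2 * n - 1 : ℕ) : ℝ) * η ≤ (2 * n : ℕ) * η := by
      gcongr
      omega
    linarith
  -- With at least two clusters the trivial bound 1 is already below `clusters c - 1`.
  · have h2 : (2 : ℝ) ≤ clusters c := by exact_mod_cast hge
    have h3 := (wp_mono (W := W) (G := G) (l := relays n id d W T 1 (2 * n - 1)) hf1
      ((localStep d W resetCast).next W G c x)).trans_eq (wp_const _ 1 _)
    have : 0 ≤ ((2 * n : ℕ) : ℝ) * η := by positivity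
    linarith

/-- The failure probability of the algorithm. -/
theorem wp_broadcastProg_le {q : ℕ} (hq : 2 ≤ q) [NeZero (q ^ 6)] (hW : 0 < W)
    (hdeg : ∀ (v : V) (S : Finset V), (∀ u ∈ S, G.Adj v u) → S.card < 2 ^ W) (hG : G.Connected)
    (hn : Fintype.card V = n) {s : V} {m : Msg} {f : (V → Main × Scratch) → ℝ}
    (hf1 : ∀ c, f c ≤ 1) (hf : ∀ c, (∀ v, (c v).1.content = m) → f c ≤ 0) (I : ℕ) :
    wp W G (broadcastProg n (q ^ 6) W T I) f (fun v => initState (input s m v)) ≤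
      (6 / q) ^ I * n + (I * (q ^ 6 * (2 * n)) + 2 * n : ℕ) * ((985 / 1000) ^ T * (n : ℝ) ^ 2) := by
  set η : ℝ := (985 / 1000) ^ T * (n : ℝ) ^ 2 with hη
  have hη0 : 0 ≤ η := by positivity
  -- Bounds affine in `clusters - 1` are preserved by prepending a merging round: the slope gains
  -- the factor 6/q, and the constant term gains the failure probability of the exchanges.
  have key : ∀ I c, Sound G s m c → wp W G (broadcastProg n (q ^ 6) W T I) f c ≤
      (6 / q) ^ I * ((clusters c : ℝ) - 1) + (I * (q ^ 6 * (2 * n)) + 2 * n : ℕ) * η := by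
    intro I
    induction I with
    | zero =>
      intro c hc
      have := wp_castProg_le (T := T) (d := q ^ 6) hW hdeg hG hn hf1 hf hc
      simpa [broadcastProg] using this
    | succ I ih =>
      intro c hc
      have e : broadcastProg n (q ^ 6) W T (I + 1) =
          mergeProg n (q ^ 6) W T ++ broadcastProg n (q ^ 6) W T I := by
        simp only [broadcastProg, List.replicate_succ, List.flatten_cons, List.append_assoc]
      rw [e, wp_append]
      refine (wp_mergeProg_le (T := T) hq hW hdeg hG hn (α := (6 / q) ^ I) (by positivity)
        (by positivity) (fun c => (wp_mono hf1 c).trans_eq (wp_const _ 1 c)) ih hc).trans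
        (le_of_eq ?_)
      push_cast
      ring
  have h0 : Sound G s m (fun v => initState (input s m v)) :=
    ⟨fun v => rfl, fun v hv => absurd rfl hv⟩
  refine (key I _ h0).trans ?_
  gcongr
  have : clusters (fun v => initState (input s m v)) ≤ n := by
    rw [← hn, ← Nat.card_eq_fintype_card]
    exact Finite.card_subtype_le _
  have : (clusters (fun v => initState (input s m v)) : ℝ) ≤ n := by exact_mod_cast this
  linarith

end correctness

end Radio

namespace Radio

open Finset

/-! ### Energy of the algorithm -/

section energy

variable {n d W T : ℕ} {rel : Msg → Msg}

/-- The number of times in `[k, k + N)` at which a device sends. -/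
def sendCount (n lab s k N : ℕ) : ℕ := ∑ j ∈ Ico k (k + N), if SendOK n j lab s then 1 else 0

/-- The number of times in `[k, k + N)` at which a device that was not yet reached listens. -/
def recvCount (n lab k N : ℕ) : ℕ := ∑ j ∈ Ico k (k + N), if RecvOK n j lab then 1 else 0

theorem sendCount_succ (n lab s k N : ℕ) : sendCount n lab s k (N + 1) =
    (if SendOK n k lab s then 1 else 0) + sendCount n lab s (k + 1) N := by
  rw [sendCount, sum_eq_sum_Ico_succ_bot (by omega), sendCount]
  congr 3
  omega

theorem recvCount_succ (n lab k N : ℕ) : recvCount n lab k (N + 1) =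
    (if RecvOK n k lab then 1 else 0) + recvCount n lab (k + 1) N := by
  rw [recvCount, sum_eq_sum_Ico_succ_bot (by omega), recvCount]
  congr 3
  omega

/-- The stamp determines the round, so each of the three clauses of `SendOK` admits only one time.
-/
theorem sendCount_le (n lab s k N : ℕ) : sendCount n lab s k N ≤ 3 := by
  rw [sendCount, ← card_filter]
  have : (Ico k (k + N)).filter (fun j => SendOK n j lab s) ⊆
      {2 * n * (s / (2 * n) + 1), 2 * n * (s / (2 * n)) + (n - lab),
        2 * n * (s / (2 * n)) + (lab + n + 1)} := by
    intro j hj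
    have h1 := Nat.div_add_mod j (2 * n)
    have hj := (mem_filter.1 hj).2
    unfold SendOK at hj
    simp only [mem_insert, mem_singleton]
    generalize j % (2 * n) = ρ at h1 hj
    rcases hj with ⟨h2, h3⟩ | ⟨-, -, h2, h3⟩ | ⟨-, h2, h3⟩ <;> rw [← h3] at h1
    · left
      omega
    · right; left
      generalize 2 * n * (s / (2 * n)) = z at h1 ⊢
      omega
    · right; right
      generalize 2 * n * (s / (2 * n)) = z at h1 ⊢
      omega
  exact (card_le_card this).trans card_le_three

theorem recvCount_le (n lab k N d : ℕ) (h : k + N ≤ d * (2 * n)) :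
    recvCount n lab k N ≤ 3 * d := by
  rw [recvCount, ← card_filter]
  set R := 2 * n with hR
  have : (Ico k (k + N)).filter (fun j => RecvOK n j lab) ⊆
      (({0, n - (lab + 1), lab + n} : Finset ℕ) ×ˢ range d).image fun p => R * p.2 + p.1 := by
    intro j hj
    obtain ⟨hj1, hj2⟩ := mem_filter.1 hj
    have h1 := Nat.div_add_mod j R
    refine mem_image.2 ⟨(j % R, j / R), mem_product.2 ⟨?_, ?_⟩, h1⟩
    · simp only [mem_insert, mem_singleton]
      rcases hj2 with h2 | ⟨-, -, h2⟩ | ⟨-, h2⟩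
      · exact Or.inl h2
      · right; left
        rw [← h2, Nat.add_sub_cancel_left]
      · exact Or.inr (Or.inr h2.symm)
    · rw [mem_range]
      have := (mem_Ico.1 hj1).2
      exact Nat.div_lt_of_lt_mul (by rw [mul_comm]; omega)
  refine (card_le_card this).trans (card_image_le.trans ?_)
  rw [card_product, card_range]
  exact Nat.mul_le_mul_right d card_le_three

/-- An upper bound for the energy spent in the exchanges at times `k, …, k + N - 1`. -/
def energyBound (n T k N : ℕ) (m : Main) : ℕ :=
  match m.got with
  | none => 4 * (T + 1) + recvCount n m.lab k N
  | some (s, _) => (T + 1) * sendCount n m.lab s k N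

/-- An unreached device reserves `4 * (T + 1)`: one unit of `T + 1` for its only costly reception
and three for sending afterwards. Each attempt that detects nobody is charged to `recvCount`; once
reached, a device never listens again. -/
theorem pay_relays (k N : ℕ) (m : Main) (q : Scratch) (e : ℕ) (he : energyBound n T k N m ≤ e)
    {Q : Main × Scratch → ℕ → Prop} (hQ : ∀ st e', e - energyBound n T k N m ≤ e' → Q st e') :
    Pay W (relays n rel d W T k N) (m, q) e Q := by
  induction N generalizing k m q e with
  | zero => exact hQ _ _ (Nat.sub_le _ _)
  | succ N ih =>
    have eq : relays n rel d W T k (N + 1) =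
        (relay n rel k).prog d W T ++ relays n rel d W T (k + 1) N := by
      simp only [relays, List.range'_succ, List.flatMap_cons]
    rw [eq, Pay_append]
    have hnext : ∀ m' e', energyBound n T (k + 1) N m' ≤ e' →
        e - energyBound n T k (N + 1) m ≤ e' - energyBound n T (k + 1) N m' →
        Pay W (relays n rel d W T (k + 1) N) (m', none) e' Q := fun m' e' h1 h2 =>
      ih (k + 1) m' none e' h1 fun st e'' h3 => hQ st e'' (h2.trans h3)
    rcases hg : m.got with _ | ⟨s, μ⟩
    · have hb : ∀ N k, energyBound n T k N m = 4 * (T + 1) + recvCount n m.lab k N := by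
        intro N k
        simp only [energyBound, hg]
      have hnew : ∀ m' : Main, (∃ s μ, m'.got = some (s, μ)) →
          energyBound n T (k + 1) N m' ≤ 3 * (T + 1) := by
        rintro m' ⟨s, μ, h⟩
        simp only [energyBound, h]
        rw [mul_comm]
        exact Nat.mul_le_mul_right _ (sendCount_le _ _ _ _ _)
      have hfin : ∀ q, (relay n rel k).fin m q = m ∧ q = none ∨
          energyBound n T (k + 1) N ((relay n rel k).fin m q) ≤ 3 * (T + 1) := by
        intro q
        simp only [relay, hg]
        rcases q with _ | p | μ
        · simp only
          split_ifs
          · exact Or.inr (hnew _ ⟨_, _, rfl⟩)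
          · exact Or.inl ⟨rfl, trivial⟩
        · exact Or.inr (hnew _ ⟨_, _, rfl⟩)
        · exact Or.inr (hnew _ ⟨_, _, rfl⟩)
      have hs := recvCount_succ n m.lab k N
      rw [hb] at he hnext
      have hb' := hb N (k + 1)
      refine (relay n rel k).pay_prog T m q e (fun h => ?_) (fun _ h => ?_) (fun _ h => ?_)
      · simp [relay, hg] at h
      · have hr : RecvOK n k m.lab := by simpa [relay, hg] using h
        rw [if_pos hr] at hs
        refine ⟨by omega, fun e' he' => ?_, fun q' e' hq' he' => ?_⟩
        · rcases hfin none with ⟨h1, -⟩ | h1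
          · rw [h1]
            exact hnext m e' (by omega) (by omega)
          · exact hnext _ e' (by omega) (by omega)
        · rcases hfin q' with ⟨-, h1⟩ | h1
          · exact absurd h1 hq'
          · exact hnext _ e' (by omega) (by omega)
      · have hr : ¬ RecvOK n k m.lab := by simpa [relay, hg] using h
        rw [if_neg hr] at hs
        rcases hfin none with ⟨h1, -⟩ | h1
        · rw [h1]
          exact hnext m e (by omega) (by omega)
        · exact hnext _ e (by omega) (by omega)
    · have hb : ∀ N k, energyBound n T k N m = (T + 1) * sendCount n m.lab s k N := by
        intro N k
        simp only [energyBound, hg]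
      have hfin : (relay n rel k).fin m none = m := relay_fin_of_got k none hg
      have hs := congrArg (fun x => (T + 1) * x) (sendCount_succ n m.lab s k N)
      simp only [mul_add] at hs
      rw [hb] at he hnext
      have hb' := hb N (k + 1)
      refine (relay n rel k).pay_prog T m q e (fun h => ?_) (fun _ h => ?_) (fun h _ => ?_)
      · have hk : SendOK n k m.lab s := by
          by_contra hk
          simp [relay, hg, hk] at h
        rw [if_pos hk, mul_one] at hs
        refine ⟨by omega, fun e' he' => ?_⟩
        rw [hfin]
        exact hnext m e' (by omega) (by omega)
      · simp [relay, hg] at h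
      · have hk : ¬ SendOK n k m.lab s := by
          intro hk
          simp [relay, hg, hk] at h
        rw [if_neg hk, mul_zero] at hs
        rw [hfin]
        exact hnext m e (by omega) (by omega)

theorem cost_localStep (g : Main → ℕ → Main) (st : Main × Scratch) (x : Sample d W) :
    (localStep d W g).cost W st x = 0 := by
  simp [Step.cost, localStep]

theorem energyBound_le {k N : ℕ} (h : k + N ≤ d * (2 * n)) (m : Main) :
    energyBound n T k N m ≤ 4 * (T + 1) + 3 * d := by
  rw [energyBound]
  rcases m.got with _ | ⟨s, μ⟩
  · exact Nat.add_le_add_left (recvCount_le _ _ _ _ _ h) _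
  · refine (Nat.mul_le_mul_left (T + 1) (sendCount_le n m.lab s k N)).trans ?_
    omega

theorem pay_localStep_relays (g : Main → ℕ → Main) {k N : ℕ} (h : k + N ≤ d * (2 * n))
    (st : Main × Scratch) (e : ℕ) (he : 4 * (T + 1) + 3 * d ≤ e) {Q : Main × Scratch → ℕ → Prop}
    (hQ : ∀ st e', e - (4 * (T + 1) + 3 * d) ≤ e' → Q st e') :
    Pay W (localStep d W g :: relays n rel d W T k N) st e Q := by
  intro x fb
  rw [cost_localStep]
  have hb := energyBound_le (T := T) h (g st.1 x.1.val)
  exact ⟨Nat.zero_le _, pay_relays k N _ none _ (by omega)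
    fun st' e' he' => hQ st' e' (by omega)⟩

/-- The energy of the algorithm. -/
theorem pay_broadcastProg (hn : 0 < n) (hd : 0 < d) (I : ℕ) (st : Main × Scratch) (e : ℕ)
    (he : (I + 1) * (4 * (T + 1) + 3 * d) ≤ e) :
    Pay W (broadcastProg n d W T I) st e fun _ _ => True := by
  induction I generalizing st e with
  | zero =>
    refine pay_localStep_relays _ ?_ _ _ (by omega) (fun _ _ _ => trivial)
    have := Nat.mul_le_mul_right (2 * n) hd
    omega
  | succ I ih =>
    have eq : broadcastProg n d W T (I + 1) = mergeProg n d W T ++ broadcastProg n d W T I := by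
      simp only [broadcastProg, List.replicate_succ, List.flatten_cons, List.append_assoc]
    rw [eq, Pay_append]
    have e2 : (I + 1 + 1) * (4 * (T + 1) + 3 * d) =
        (I + 1) * (4 * (T + 1) + 3 * d) + (4 * (T + 1) + 3 * d) := by ring
    rw [e2] at he
    exact pay_localStep_relays _ (by omega) _ _ (by omega) fun st' e' he' => ih st' e' (by omega)

theorem length_relays (n : ℕ) (rel : Msg → Msg) (d W T k₀ N : ℕ) :
    (relays n rel d W T k₀ N).length = N * (T + 2) := by
  simp [relays, List.length_flatMap, Exchange.length_prog]

/-- The number of macro-steps of the algorithm. -/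
theorem length_broadcastProg_le (n T : ℕ) {d : ℕ} (hd : 0 < d) (I : ℕ) :
    (broadcastProg n d W T I).length ≤ (I + 1) * (1 + d * (2 * n) * (T + 2)) := by
  have h1 : (mergeProg n d W T).length = 1 + d * (2 * n) * (T + 2) := by
    simp [mergeProg, length_relays, add_comm]
  have h2 : (castProg n d W T).length ≤ 1 + d * (2 * n) * (T + 2) := by
    rw [castProg, List.length_cons, length_relays, add_comm]
    gcongr
    have := Nat.mul_le_mul_right (2 * n) hd
    omega
  rw [broadcastProg, List.length_append, List.length_flatten, List.map_replicate,
    List.sum_replicate, h1, smul_eq_mul]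
  linarith

end energy

end Radio

namespace Radio

open Finset

/-! ### Choice of the parameters -/

theorem one_lt_log_of_three_le {n : ℕ} (hn : 3 ≤ n) : 1 < Real.log n := by
  rw [Real.lt_log_iff_exp_lt (by positivity)]
  have : (3 : ℝ) ≤ n := by exact_mod_cast hn
  linarith [Real.exp_one_lt_d9]

/-- The number `q ^ 6` of delays, `q = 2 ^ D`, is of order `(log n) ^ ε`. -/
theorem exists_delay_range {ℓ ε : ℝ} (hℓ : 1 < ℓ) (hε : 0 < ε) :
    ∃ D : ℕ, 12 * ℓ ^ (ε / 6) ≤ (2 : ℝ) ^ D ∧ ((2 : ℝ) ^ D) ^ 6 ≤ 24 ^ 6 * ℓ ^ ε := by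
  have hy : 1 ≤ ℓ ^ (ε / 6) := Real.one_le_rpow hℓ.le (by positivity)
  obtain ⟨D, h1, h2⟩ := exists_nat_pow_near (x := 12 * ℓ ^ (ε / 6)) (y := 2) (by linarith)
    (by norm_num)
  refine ⟨D + 1, h2.le, ?_⟩
  have h3 : (2 : ℝ) ^ (D + 1) ≤ 24 * ℓ ^ (ε / 6) := by
    rw [pow_succ]
    linarith
  calc ((2 : ℝ) ^ (D + 1)) ^ 6 ≤ (24 * ℓ ^ (ε / 6)) ^ 6 := by gcongr
    _ = 24 ^ 6 * ℓ ^ ε := by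
      rw [mul_pow, ← Real.rpow_natCast (ℓ ^ (ε / 6)), ← Real.rpow_mul (by linarith)]
      congr 2
      push_cast
      ring

/-- The number of rounds of merging. -/
theorem exists_rounds (k : ℕ) {n : ℕ} (hn : 3 ≤ n) {ε : ℝ} (hε : 0 < ε) (hε1 : ε < 1) {q : ℝ}
    (hq : 12 * Real.log n ^ (ε / 6) ≤ q) :
    ∃ I : ℕ, ((I : ℝ) + 1) ≤ (6 * k + 14) * (Real.log n / (ε * Real.log (Real.log n))) ∧
      ((I : ℝ) + 1) ≤ (2 * k + 6) * n ∧ (6 / q) ^ I * n ≤ 1 / (n : ℝ) ^ (k + 1) := by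
  have hn' : (3 : ℝ) ≤ n := by exact_mod_cast hn
  have hℓ := one_lt_log_of_three_le hn
  set ℓ := Real.log n with hℓdef
  set L := Real.log ℓ with hL
  have hL0 : 0 < L := Real.log_pos hℓ
  have hLℓ : L ≤ ℓ := (Real.log_le_sub_one_of_pos (by linarith)).trans (by linarith)
  have hℓn : ℓ ≤ n := (Real.log_le_sub_one_of_pos (by linarith)).trans (by linarith)
  set y := ℓ ^ (ε / 6) with hy
  have hy1 : 1 ≤ y := Real.one_le_rpow hℓ.le (by positivity)
  have hlog : Real.log (2 * y) = Real.log 2 + ε / 6 * L := by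
    rw [Real.log_mul (by norm_num) (by linarith), hy, Real.log_rpow (by linarith)]
  have hlog2 : 1 / 2 ≤ Real.log 2 := by linarith [Real.log_two_gt_d9]
  have hεL : 0 < ε * L := by positivity
  have hpos : 0 < Real.log (2 * y) := by rw [hlog]; positivity
  -- Since 6/q ≤ 1/(2y), this many rounds give n^-(k+2). The factor 2 keeps `log (2 * y)` away from
  -- 0, so the bound linear in `n` is uniform in ε; it keeps the number of phases independent of ε.
  set a := (k + 2) * ℓ / Real.log (2 * y) with ha
  have ha0 : 0 ≤ a := by positivity
  have hI := Nat.ceil_lt_add_one ha0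
  refine ⟨⌈a⌉₊, ?_, ?_, ?_⟩
  · have h1 : a ≤ (6 * k + 12) * (ℓ / (ε * L)) := by
      rw [ha, hlog, div_le_iff₀ (by positivity)]
      have : (6 * k + 12) * (ℓ / (ε * L)) * (ε / 6 * L) = (k + 2) * ℓ := by
        field_simp
        ring
      have h2 : 0 ≤ (6 * k + 12) * (ℓ / (ε * L)) * Real.log 2 := by positivity
      rw [mul_add, this]
      linarith
    have h3 : 1 ≤ ℓ / (ε * L) := by
      rw [le_div_iff₀ hεL]
      nlinarith
    linarith
  · have h1 : a ≤ (2 * k + 4) * n := by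
      rw [ha, div_le_iff₀ hpos]
      have h2 : 1 / 2 ≤ Real.log (2 * y) := by
        rw [hlog]
        have : 0 ≤ ε / 6 * L := by positivity
        linarith
      calc (k + 2) * ℓ ≤ (k + 2) * n := by gcongr
        _ = (2 * k + 4) * n * (1 / 2) := by ring
        _ ≤ _ := by gcongr
    linarith
  · have h1 : 6 / q ≤ Real.exp (-Real.log (2 * y)) := by
      rw [Real.exp_neg, Real.exp_log (by linarith), ← one_div,
        div_le_div_iff₀ (by linarith) (by linarith)]
      linarith
    have hq0 : 0 < q := by linarith
    have h2 : (6 / q) ^ ⌈a⌉₊ ≤ Real.exp (-((k + 2) * ℓ)) := by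
      calc (6 / q) ^ ⌈a⌉₊ ≤ Real.exp (-Real.log (2 * y)) ^ ⌈a⌉₊ := by gcongr
        _ = Real.exp (-(⌈a⌉₊ * Real.log (2 * y))) := by rw [← Real.exp_nat_mul]; ring_nf
        _ ≤ _ := by
          refine Real.exp_le_exp.2 (neg_le_neg ?_)
          rw [← div_le_iff₀ hpos]
          exact Nat.le_ceil a
    have h3 : Real.exp (-((k + 2) * ℓ)) = 1 / (n : ℝ) ^ (k + 2) := by
      rw [Real.exp_neg, one_div]
      congr 1
      have : ((k : ℝ) + 2) = ((k + 2 : ℕ) : ℝ) := by push_cast; ring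
      rw [this, Real.exp_nat_mul, Real.exp_log (by linarith)]
    rw [h3] at h2
    calc (6 / q) ^ ⌈a⌉₊ * n ≤ 1 / (n : ℝ) ^ (k + 2) * n := by gcongr
      _ = _ := by
        rw [pow_succ (n : ℝ) (k + 1)]
        field_simp

/-- The number of phases of an exchange. -/
theorem exists_phases (c : ℕ) {n : ℕ} (hn : 3 ≤ n) :
    ∃ T : ℕ, (T : ℝ) ≤ (100 * c + 1) * Real.log n ∧
      (985 / 1000 : ℝ) ^ T ≤ 1 / (n : ℝ) ^ c := by
  have hn' : (3 : ℝ) ≤ n := by exact_mod_cast hn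
  have hℓ := one_lt_log_of_three_le hn
  set a := 100 * c * Real.log n with ha
  have ha0 : 0 ≤ a := by positivity
  refine ⟨⌈a⌉₊, ?_, ?_⟩
  · have := Nat.ceil_lt_add_one ha0
    linarith
  · have h1 : (985 / 1000 : ℝ) ≤ Real.exp (-(1 / 100)) := by
      linarith [Real.add_one_le_exp (-(1 / 100) : ℝ)]
    calc (985 / 1000 : ℝ) ^ ⌈a⌉₊ ≤ Real.exp (-(1 / 100)) ^ ⌈a⌉₊ := by gcongr
      _ = Real.exp (-(⌈a⌉₊ / 100)) := by rw [← Real.exp_nat_mul]; ring_nf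
      _ ≤ Real.exp (-(c * Real.log n)) := by
        refine Real.exp_le_exp.2 (neg_le_neg ?_)
        have := Nat.le_ceil a
        linarith
      _ = _ := by rw [Real.exp_neg, Real.exp_nat_mul, Real.exp_log (by linarith), one_div]

theorem log_two_add_one_le {Δ : ℕ} (hΔ : 2 ≤ Δ) :
    ((Nat.log 2 Δ + 1 : ℕ) : ℝ) ≤ 4 * Real.log Δ := by
  have h1 : (2 : ℝ) ^ Nat.log 2 Δ ≤ Δ := by exact_mod_cast Nat.pow_log_le_self 2 (by omega)
  have h2 := Real.log_le_log (by positivity) h1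
  rw [Real.log_pow] at h2
  have h3 : Real.log 2 ≤ Real.log Δ := Real.log_le_log (by norm_num) (by exact_mod_cast hΔ)
  have h4 := Real.log_two_gt_d9
  push_cast
  have h5 : (Nat.log 2 Δ : ℝ) * (1 / 2) ≤ Nat.log 2 Δ * Real.log 2 := by
    gcongr
    linarith
  linarith

/-- The parameters of the algorithm. -/
theorem exists_parameters (k : ℕ) : ∃ C : ℝ, 0 < C ∧ ∀ ε : ℝ, 0 < ε → ε < 1 → ∀ n Δ : ℕ, 3 ≤ n →
    2 ≤ Δ → ∃ D T I W : ℕ, 1 ≤ D ∧ 0 < W ∧ Δ < 2 ^ W ∧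
      ((((I + 1) * (1 + (2 ^ D) ^ 6 * (2 * n) * (T + 2))) * W : ℕ) : ℝ) ≤
        C * ((n : ℝ) * Real.log (Δ : ℝ) * Real.log (n : ℝ) ^ (2 + ε) /
              (ε * Real.log (Real.log (n : ℝ)))) ∧
      (((I + 1) * (4 * (T + 1) + 3 * (2 ^ D) ^ 6) : ℕ) : ℝ) ≤
        C * (Real.log (n : ℝ) ^ 2 / (ε * Real.log (Real.log (n : ℝ)))) ∧
      (6 / ((2 ^ D : ℕ) : ℝ)) ^ I * n + (I * ((2 ^ D) ^ 6 * (2 * n)) + 2 * n : ℕ) *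
        ((985 / 1000) ^ T * (n : ℝ) ^ 2) ≤ 1 / (n : ℝ) ^ k := by
  -- Union bound: the number of exchanges times n² is at most `c₀ * n ^ 5 / 2`, and the constant is
  -- absorbed by `c₀ ≤ n ^ c₀`. Hence each exchange needs error n^-(k + 5 + c₀).
  set c₀ : ℕ := 4 * ((2 * k + 6) * 24 ^ 6) with hc₀
  set c : ℕ := k + 5 + c₀ with hc
  set c₁ : ℝ := 6 * k + 14 with hc₁
  set c₂ : ℝ := 100 * c + 4 with hc₂
  have hc₁0 : 0 < c₁ := by positivity
  have hc₂0 : 0 < c₂ := by positivity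
  refine ⟨c₁ * (24 ^ 6 * 2 * c₂) * 4 + c₁ * (4 * c₂ + 3 * 24 ^ 6), by positivity, ?_⟩
  intro ε hε hε1 n Δ hn hΔ
  have hn' : (3 : ℝ) ≤ n := by exact_mod_cast hn
  have hℓ := one_lt_log_of_three_le hn
  have hℓn : Real.log n ≤ n := (Real.log_le_sub_one_of_pos (by linarith)).trans (by linarith)
  obtain ⟨D, hD1, hD2⟩ := exists_delay_range hℓ hε
  obtain ⟨I, hI1, hI2, hI3⟩ := exists_rounds k hn hε hε1 hD1
  obtain ⟨T, hT1, hT2⟩ := exists_phases c hn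
  have hy1 : 1 ≤ Real.log n ^ (ε / 6) := Real.one_le_rpow hℓ.le (by positivity)
  have hW := log_two_add_one_le hΔ
  have hlogΔ : 0 ≤ Real.log Δ := Real.log_natCast_nonneg Δ
  refine ⟨D, T, I, Nat.log 2 Δ + 1, ?_, Nat.succ_pos _, Nat.lt_pow_succ_log_self (by norm_num) Δ,
    ?_, ?_, ?_⟩
  · rcases Nat.eq_zero_or_pos D with rfl | h
    · rw [pow_zero] at hD1
      linarith
    · exact h
  all_goals push_cast at hW ⊢
  all_goals
    set ℓ := Real.log n with hℓdef
    set L := Real.log ℓ with hL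
    have hL0 : 0 < L := Real.log_pos hℓ
    have hεL : 0 < ε * L := by positivity
    have hp : 1 ≤ ℓ ^ ε := Real.one_le_rpow hℓ.le hε.le
    have hpℓ : ℓ ^ ε ≤ ℓ := by
      calc ℓ ^ ε ≤ ℓ ^ (1 : ℝ) := Real.rpow_le_rpow_of_exponent_le hℓ.le hε1.le
        _ = ℓ := Real.rpow_one ℓ
    set d : ℝ := ((2 : ℝ) ^ D) ^ 6 with hd
    have hd1 : 1 ≤ d := one_le_pow₀ (one_le_pow₀ (by norm_num))
  · have h1 : 1 + d * (2 * n) * (T + 2) ≤ (24 ^ 6 * ℓ ^ ε) * (2 * n) * (c₂ * ℓ) := by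
      calc 1 + d * (2 * n) * ((T : ℝ) + 2) ≤ d * (2 * n) * (T + 3) := by nlinarith
        _ ≤ (24 ^ 6 * ℓ ^ ε) * (2 * n) * (c₂ * ℓ) := by
          gcongr
          rw [hc₂]
          linarith
    have h2 : ℓ ^ (2 + ε) = ℓ ^ 2 * ℓ ^ ε := by
      rw [Real.rpow_add (by linarith)]
      norm_num
    calc ((I : ℝ) + 1) * (1 + d * (2 * n) * (T + 2)) * (Nat.log 2 Δ + 1)
        ≤ (c₁ * (ℓ / (ε * L))) * ((24 ^ 6 * ℓ ^ ε) * (2 * n) * (c₂ * ℓ)) * (4 * Real.log Δ) := by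
          gcongr
      _ = (c₁ * (24 ^ 6 * 2 * c₂) * 4) * (n * Real.log Δ * ℓ ^ (2 + ε) / (ε * L)) := by
          rw [h2]
          ring
      _ ≤ _ := by
          gcongr
          have : 0 ≤ c₁ * (4 * c₂ + 3 * 24 ^ 6) := by positivity
          linarith
  · have h1 : 4 * ((T : ℝ) + 1) + 3 * d ≤ (4 * c₂ + 3 * 24 ^ 6) * ℓ := by
      have h2 : (T : ℝ) + 1 ≤ c₂ * ℓ := by rw [hc₂]; linarith
      have h3 : d ≤ 24 ^ 6 * ℓ := hD2.trans (by gcongr)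
      linarith
    calc ((I : ℝ) + 1) * (4 * (T + 1) + 3 * d)
        ≤ (c₁ * (ℓ / (ε * L))) * ((4 * c₂ + 3 * 24 ^ 6) * ℓ) := by gcongr
      _ = (c₁ * (4 * c₂ + 3 * 24 ^ 6)) * (ℓ ^ 2 / (ε * L)) := by ring
      _ ≤ _ := by
          gcongr
          have : 0 ≤ c₁ * (24 ^ 6 * 2 * c₂) * 4 := by positivity
          linarith
  · have h1 : 1 / (n : ℝ) ^ (k + 1) ≤ 1 / 2 * (1 / (n : ℝ) ^ k) := by
      rw [pow_succ, one_div_mul_one_div]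
      apply one_div_le_one_div_of_le (by positivity)
      rw [mul_comm]
      gcongr
      linarith
    have h2 : (I : ℝ) * (d * (2 * n)) + 2 * n ≤ ((2 * k + 6) * n) * (24 ^ 6 * n * (2 * n)) := by
      calc (I : ℝ) * (d * (2 * n)) + 2 * n ≤ (I + 1) * (d * (2 * n)) := by nlinarith
        _ ≤ ((2 * k + 6) * n) * (24 ^ 6 * n * (2 * n)) := by
          gcongr
          exact hD2.trans (by gcongr; linarith)
    have h3 : (c₀ : ℝ) ≤ (n : ℝ) ^ c₀ := by
      have : c₀ ≤ n ^ c₀ := (Nat.lt_pow_self (by omega)).le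
      exact_mod_cast this
    have h4 : ((I : ℝ) * (d * (2 * n)) + 2 * n) * ((985 / 1000) ^ T * (n : ℝ) ^ 2) ≤
        1 / 2 * (1 / (n : ℝ) ^ k) := by
      calc ((I : ℝ) * (d * (2 * n)) + 2 * n) * ((985 / 1000) ^ T * (n : ℝ) ^ 2)
          ≤ (((2 * k + 6) * n) * (24 ^ 6 * n * (2 * n))) * (1 / (n : ℝ) ^ c * (n : ℝ) ^ 2) := by
            gcongr
        _ = 1 / 2 * (c₀ * (n : ℝ) ^ 5 / (n : ℝ) ^ c) := by
            rw [hc₀]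
            push_cast
            ring
        _ ≤ 1 / 2 * ((n : ℝ) ^ c₀ * (n : ℝ) ^ 5 / (n : ℝ) ^ c) := by gcongr
        _ = _ := by
            rw [hc, pow_add, pow_add]
            field_simp
    linarith

/-- A connected graph with at least three vertices has a vertex of degree at least two. -/
theorem two_le_maxDegree {V : Type*} [Fintype V] (G : SimpleGraph V) [DecidableRel G.Adj]
    (hG : G.Connected) (hV : 3 ≤ Fintype.card V) : 2 ≤ G.maxDegree := by
  classical
  by_contra hlt
  have h1 := hG.card_vert_le_card_edgeSet_add_one
  have h2 := G.sum_degrees_eq_twice_card_edges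
  have h3 : ∑ v, G.degree v ≤ Fintype.card V * 1 := by
    rw [← smul_eq_mul, ← card_univ]
    exact sum_le_card_nsmul _ _ _ fun v _ => (G.degree_le_maxDegree v).trans (by omega)
  rw [Nat.card_eq_fintype_card, Nat.card_eq_fintype_card, ← SimpleGraph.edgeFinset_card] at h1
  omega

end Radio

/-! ### Assembly of the main theorem -/

theorem mainTheorem9 :
    ∀ k : ℕ, ∃ C : ℝ, 0 < C ∧
      ∀ ε : ℝ, 0 < ε → ε < 1 → ∀ n Δ : ℕ, 3 ≤ n →
        ∃ P : Radio.Protocol,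
          (P.slots : ℝ) ≤
            C * ((n : ℝ) * Real.log (Δ : ℝ) * Real.log (n : ℝ) ^ (2 + ε) /
              (ε * Real.log (Real.log (n : ℝ)))) ∧
          ∀ (V : Type*) [Fintype V] (G : SimpleGraph V) [DecidableRel G.Adj],
            G.Connected → Fintype.card V = n → G.maxDegree = Δ →
            ∀ (s : V) (m : Radio.Msg),
              (∀ (r : V → Fin P.bits → Bool) (v : V),
                (P.energy G s m r v : ℝ) ≤
                  C * (Real.log (n : ℝ) ^ 2 / (ε * Real.log (Real.log (n : ℝ))))) ∧
              1 - 1 / (n : ℝ) ^ k ≤ P.successProb G s m := by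
  intro k
  obtain ⟨C, hC, h⟩ := Radio.exists_parameters k
  refine ⟨C, hC, fun ε hε hε1 n Δ hn => ?_⟩
  have hℓ := Radio.one_lt_log_of_three_le hn
  have hL := Real.log_pos hℓ
  rcases Nat.lt_or_ge Δ 2 with hΔ | hΔ
  -- No connected graph on at least three vertices has maximum degree below 2, so any protocol
  -- without slots will do.
  · refine ⟨⟨0, 0, fun _ _ _ => Radio.Act.idle, fun _ _ _ => []⟩, ?_, ?_⟩
    · have := Real.log_natCast_nonneg Δ
      simp only [Nat.cast_zero]
      have h2 : 0 ≤ Real.log (n : ℝ) ^ (2 + ε) := Real.rpow_nonneg (by linarith) _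
      positivity
    · intro V _ G _ hG hV hmax
      have := Radio.two_le_maxDegree G hG (by omega)
      omega
  · obtain ⟨D, T, I, W, hD, hW, hΔW, hslots, henergy, hprob⟩ := h ε hε hε1 n Δ hn hΔ
    have hq : 2 ≤ 2 ^ D := by
      calc 2 = 2 ^ 1 := rfl
        _ ≤ 2 ^ D := Nat.pow_le_pow_right (by norm_num) hD
    have : NeZero ((2 ^ D) ^ 6) := ⟨by positivity⟩
    -- Both ranges are powers of two, so fair bits produce exactly uniform samples.
    have e : (Fin (D * 6 + W) → Bool) ≃ Radio.Sample ((2 ^ D) ^ 6) W :=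
      Fintype.equivOfCardEq (by simp [pow_add, pow_mul])
    refine ⟨Radio.toProtocol W (Radio.broadcastProg n ((2 ^ D) ^ 6) W T I) e Radio.initState
      (fun st => st.1.content), ?_, ?_⟩
    · refine le_trans ?_ hslots
      have := Radio.length_broadcastProg_le (W := W) n T (d := (2 ^ D) ^ 6) (by positivity) I
      exact_mod_cast Nat.mul_le_mul_right W this
    · intro V _ G _ hG hV hmax s m
      refine ⟨fun r v => le_trans ?_ henergy, ?_⟩
      · have := Radio.toProtocol_energy_le W (Radio.broadcastProg n ((2 ^ D) ^ 6) W T I) e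
          Radio.initState (fun st => st.1.content) G s m r v _
          (Radio.pay_broadcastProg (by omega) (by positivity) I _ _ le_rfl)
        exact_mod_cast this
      · classical
        rw [Radio.toProtocol_successProb]
        refine sub_le_sub_left (le_trans ?_ hprob) 1
        refine Radio.wp_broadcastProg_le hq hW (fun v S hS => ?_) hG hV (fun c => ?_)
          (fun c hc => ?_) I
        · refine lt_of_le_of_lt ?_ hΔW
          rw [← hmax]
          refine le_trans (Finset.card_le_card fun u hu => ?_) (G.degree_le_maxDegree v)
          exact (G.mem_neighborFinset v u).2 (hS u hu)
        · split_ifs <;> norm_num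
        · rw [if_pos hc]
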